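/- **Theorem (Existence of a threshold force).** Let $n \ge 0$ be an integer, let $T^n = (\mathbb{R}/\mathbb{Z})^n$ be the flat torus, and let $\varphi \colon T^n \times \mathbb{R} \to \mathbb{R}$ be Lipschitz continuous, $1$-periodic in the second variable, i.e. $\varphi(x,y+1) = \varphi(x,y)$, and of vanishing average, $\int_{T^n \times [0,1)} \varphi = 0$. For $F \in \mathbb{R}$ consider the stationary equation $$0 = -(-\Delta)^{1/2} g(x) + \varphi(x,g(x)) + F, \qquad x \in T^n, \tag{$S_F$}$$ where $(-\Delta)^{1/2}$ is the Fourier multiplier $\hat g(k) \mapsto 2\pi|k|\,\hat g(k)$, $k \in \mathbb{Z}^n$, with $|k|$ the Euclidean length. A *weak solution* of $(S_F)$ is a function $g \in H^{1/2}(T^n)$, that is, a real $g \in L^2(T^n)$ with $\sum_k |k|\,|\hat g(k)|^2 < \infty$, such that $$0 = -\sum_{k \in \mathbb{Z}^n} 2\pi |k|\, \hat g(k)\, \overline{\hat v(k)} + \int_{T^n} \bigl(\varphi(x,g(x)) + F\bigr)\, v(x)\, dx \qquad \text{for all } v \in H^{1/2}(T^n).$$ A *classical solution* is a continuous function $g$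 such that $(-\Delta)^{1/2} g$ is a continuous function and $(S_F)$ holds at every point of $T^n$. Then there is a real number $F^* \ge 0$ such that 1. for every $F$ with $0 \le F \le F^*$ there is a function $g$ that is both a weak and a classical solution of $(S_F)$; 2. for every $F > F^*$ the equation $(S_F)$ has neither a weak nor a classical solution. -/

import Mathlib

open MeasureTheory

noncomputable section

namespace StickSlip

/-- The flat torus `Tⁿ = (ℝ/ℤ)ⁿ`. -/
abbrev Torus (n : ℕ) : Type := UnitAddTorus (Fin n)

/-- The normalized Haar (= Lebesgue) measure on `Tⁿ`; it is the measure with respect to which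
Mathlib's `UnitAddTorus.mFourierCoeff` is defined. -/
abbrev torusMeasure (n : ℕ) : Measure (Torus n) :=
  Measure.pi fun _ => AddCircle.haarAddCircle

/-- The Fourier coefficient `ĝ(k) = ∫ g(x) exp(-2πi k·x) dx` of a real function on `Tⁿ`. -/
def fourierHat {n : ℕ} (g : Torus n → ℝ) (k : Fin n → ℤ) : ℂ :=
  UnitAddTorus.mFourierCoeff (fun x => (g x : ℂ)) k

/-- The eigenvalue `2π|k|` (with `|k|` the Euclidean length of `k`) of `(-Δ)^{1/2}` on `Tⁿ` for
the eigenfunction `x ↦ exp(2πi k·x)`. -/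
def halfSymbol {n : ℕ} (k : Fin n → ℤ) : ℝ :=
  2 * Real.pi * Real.sqrt (∑ i, (k i : ℝ) ^ 2)

/-- The interaction force `φ(x, y)`, `x ∈ Tⁿ`, `y ∈ ℝ`: it is `1`-periodic in `y`, has vanishing
average over `Tⁿ × [0,1)` and is Lipschitz continuous. -/
structure IsInteractionForce {n : ℕ} (φ : Torus n → ℝ → ℝ) : Prop where
  periodic : ∀ x y, φ x (y + 1) = φ x y
  average_zero : ∫ p in Set.univ ×ˢ Set.Ico (0 : ℝ) 1, φ p.1 p.2
    ∂((torusMeasure n).prod volume) = 0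
  lipschitz : ∃ L, LipschitzWith L (Function.uncurry φ)

/-- `g ∈ H^{1/2}(Tⁿ)`. -/
def MemHHalf {n : ℕ} (g : Torus n → ℝ) : Prop :=
  MemLp g 2 (torusMeasure n) ∧ Summable fun k => halfSymbol k * ‖fourierHat g k‖ ^ 2

/-- The bilinear form `⟨(-Δ)^{1/2} g, v⟩ = ∑ₖ 2π|k| ĝ(k) conj(v̂(k))` of the `H^{1/2}` seminorm.
The terms for `k` and `-k` are complex conjugates, so the sum is that of the real parts; it
converges absolutely for `g, v ∈ H^{1/2}` by the Cauchy-Schwarz inequality. -/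
def halfForm {n : ℕ} (g v : Torus n → ℝ) : ℝ :=
  ∑' k, halfSymbol k * (fourierHat g k * (starRingEnd ℂ) (fourierHat v k)).re

/-- `g ∈ H^{1/2}(Tⁿ)` is a weak solution of `0 = -(-Δ)^{1/2} g + φ(x, g(x)) + F`. -/
def IsWeakSolution {n : ℕ} (φ : Torus n → ℝ → ℝ) (F : ℝ) (g : Torus n → ℝ) : Prop :=
  MemHHalf g ∧ ∀ v, MemHHalf v →
    0 = -halfForm g v + ∫ x, (φ x (g x) + F) * v x ∂(torusMeasure n)

/-- `h = (-Δ)^{1/2} g` for continuous functions `g` and `h` on `Tⁿ`: both are continuous and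
`ĥ(k) = 2π|k| ĝ(k)` for all `k`. A continuous function is determined by its Fourier coefficients,
so there is at most one such `h`. This is the graph of the operator `(-Δ)^{1/2}` on the space of
continuous functions (minus the generator of the Poisson semigroup). -/
def IsHalfLaplacian {n : ℕ} (g h : Torus n → ℝ) : Prop :=
  Continuous g ∧ Continuous h ∧
    ∀ k, fourierHat h k = (halfSymbol k : ℂ) * fourierHat g k

/-- `g` is a classical solution: `g` and `(-Δ)^{1/2} g` are continuous, and
`0 = -(-Δ)^{1/2} g(x) + φ(x, g(x)) + F` holds at every point `x`. -/
def IsClassicalSolution {n : ℕ} (φ : Torus n → ℝ → ℝ) (F : ℝ) (g : Torus n → ℝ) : Prop :=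
  ∃ h, IsHalfLaplacian g h ∧ ∀ x, 0 = -h x + φ x (g x) + F

end StickSlip

end

/-! Let L > 0 be a Lipschitz constant of φ in y and M a bound of |φ|. Adding L u to both sides turns
the equation into the fixed point problem u = T_F u on L², where T_F u = (L + (-Δ)^{1/2})⁻¹(L u +
φ(·,u) + F) is `step`. The map T_F is continuous and commutes with adding integer constants. It
preserves order, because y ↦ L y + φ(x,y) is nondecreasing and the resolvent is positive. The
resolvent is compact, because its symbol tends to 0. Hence bounded approximate fixed points
subconverge to a fixed point (`exists_step_eq_of_tendsto`).

Let S be the set of F for which T_F has a fixed point. Then F* = sup S works, for four reasons. 0 ∈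
S: vanishing average makes the energy invariant under integer shifts, so a minimising sequence can
be taken with bounded mean, and it is then bounded. Since T_0 lowers the energy by at least
(L/2)‖T_0 u - u‖², the sequence consists of approximate fixed points (`exists_step_zero_eq`). S ≤ M:
integrate the equation over the torus. sup S ∈ S: shift solutions by integers to bound their means;
the spectral gap bounds the rest (`exists_step_eq_of_tendsto_force`). S is an interval: solutions at
F₀ ≤ F ≤ F₁, ordered by an integer shift, are a sub- and a supersolution at F, and iterating T_F
from below converges (`exists_step_eq_of_between`).

Positivity of the resolvent comes from writing 2π|k| as an integral of 1 - cos, which makes the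
seminorm an average of squared translation differences, so u ↦ |u| does not increase it. Fixed
points have continuous representatives by bootstrapping with resolvents, so they are both weak and
classical solutions; conversely either kind of solution is a fixed point. -/

noncomputable section

namespace StickSlip

variable {n : ℕ}

/-! ### Fourier coefficients of real L² functions and Parseval's identity -/

/-- The real Hilbert space `L²(Tⁿ)`. -/
abbrev L2 (n : ℕ) : Type := Lp ℝ 2 (torusMeasure n)

/-- The complex Hilbert space `L²(Tⁿ; ℂ)`. -/
abbrev L2C (n : ℕ) : Type := Lp ℂ 2 (torusMeasure n)

/-- The Fourier basis of `L²(Tⁿ; ℂ)`. -/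
def fourierBasis (n : ℕ) : HilbertBasis (Fin n → ℤ) ℂ (L2C n) :=
  UnitAddTorus.mFourierBasis

theorem fourierBasis_repr (f : L2C n) (k : Fin n → ℤ) :
    (fourierBasis n).repr f k = UnitAddTorus.mFourierCoeff f k :=
  UnitAddTorus.mFourierBasis_repr f k

theorem mFourierCoeff_eq (f : Torus n → ℂ) (k : Fin n → ℤ) :
    UnitAddTorus.mFourierCoeff f k
      = ∫ t, UnitAddTorus.mFourier (-k) t * f t ∂(torusMeasure n) := rfl

theorem fourierHat_eq (f : Torus n → ℝ) (k : Fin n → ℤ) :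
    fourierHat f k
      = ∫ t, UnitAddTorus.mFourier (-k) t * (f t : ℂ) ∂(torusMeasure n) := rfl

theorem mFourierCoeff_congr_ae {f g : Torus n → ℂ} (h : f =ᵐ[torusMeasure n] g) :
    UnitAddTorus.mFourierCoeff f = UnitAddTorus.mFourierCoeff g := by
  funext k
  rw [mFourierCoeff_eq, mFourierCoeff_eq]
  exact integral_congr_ae (h.mono fun x hx => by simp only [hx])

theorem fourierHat_congr_ae {f g : Torus n → ℝ} (h : f =ᵐ[torusMeasure n] g) :
    fourierHat f = fourierHat g :=
  mFourierCoeff_congr_ae (h.mono fun x hx => by simp only [hx])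

/-- The inclusion of real into complex `L²`. -/
def complexify (n : ℕ) : L2 n →L[ℝ] L2C n := Complex.ofRealCLM.compLpL 2 (torusMeasure n)

/-- The real part of a complex `L²` function. -/
def realPart (n : ℕ) : L2C n →L[ℝ] L2 n := Complex.reCLM.compLpL 2 (torusMeasure n)

theorem coeFn_complexify (u : L2 n) :
    complexify n u =ᵐ[torusMeasure n] fun x => (u x : ℂ) :=
  Complex.ofRealCLM.coeFn_compLpL u

theorem coeFn_realPart (u : L2C n) :
    realPart n u =ᵐ[torusMeasure n] fun x => (u x).re :=
  Complex.reCLM.coeFn_compLpL u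

theorem norm_complexify (u : L2 n) : ‖complexify n u‖ = ‖u‖ := by
  apply le_antisymm <;> apply Lp.norm_le_norm_of_ae_le <;>
    filter_upwards [coeFn_complexify u] with x hx <;> simp [hx]

/-- The Fourier coefficients of an `L²` function. -/
def coeffs (u : L2 n) : lp (fun _ : Fin n → ℤ => ℂ) 2 := (fourierBasis n).repr (complexify n u)

theorem coeffs_apply (u : L2 n) (k : Fin n → ℤ) : coeffs u k = fourierHat u k := by
  rw [coeffs, fourierBasis_repr, fourierHat]
  exact congrFun (mFourierCoeff_congr_ae (coeFn_complexify u)) k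

theorem norm_coeffs (u : L2 n) : ‖coeffs u‖ = ‖u‖ := by
  rw [coeffs, LinearIsometryEquiv.norm_map, norm_complexify]

theorem coeffs_add (u v : L2 n) : coeffs (u + v) = coeffs u + coeffs v := by simp [coeffs]

theorem coeffs_sub (u v : L2 n) : coeffs (u - v) = coeffs u - coeffs v := by simp [coeffs]

theorem coeffs_smul (c : ℝ) (u : L2 n) : coeffs (c • u) = (c : ℂ) • coeffs u := by
  have h : complexify n (c • u) = (c : ℂ) • complexify n u := by
    rw [map_smul]
    exact (algebraMap_smul ℂ c (complexify n u)).symm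
  rw [coeffs, h, map_smul, coeffs]

theorem fourierHat_add (u v : L2 n) (k : Fin n → ℤ) :
    fourierHat (u + v : L2 n) k = fourierHat u k + fourierHat v k := by
  simp only [← coeffs_apply, coeffs_add, lp.coeFn_add, Pi.add_apply]

theorem fourierHat_sub (u v : L2 n) (k : Fin n → ℤ) :
    fourierHat (u - v : L2 n) k = fourierHat u k - fourierHat v k := by
  simp only [← coeffs_apply, coeffs_sub, lp.coeFn_sub, Pi.sub_apply]

theorem fourierHat_smul (c : ℝ) (u : L2 n) (k : Fin n → ℤ) :
    fourierHat (c • u : L2 n) k = c * fourierHat u k := by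
  simp only [← coeffs_apply, coeffs_smul, lp.coeFn_smul, Pi.smul_apply, smul_eq_mul]

theorem ext_fourierHat {u v : L2 n} (h : ∀ k, fourierHat u k = fourierHat v k) : u = v := by
  rw [← sub_eq_zero, ← norm_eq_zero, ← norm_coeffs, norm_eq_zero, coeffs_sub, sub_eq_zero]
  ext k
  rw [coeffs_apply, coeffs_apply, h]

/-- Parseval's identity. -/
theorem hasSum_inner (u v : L2 n) :
    HasSum (fun k => (fourierHat u k * (starRingEnd ℂ) (fourierHat v k)).re) (inner ℝ u v) := by
  have h1 := lp.hasSum_inner (𝕜 := ℂ) (coeffs v) (coeffs u)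
  have h2 := RCLike.hasSum_re ℂ h1
  convert h2 using 1
  · funext k
    simp [coeffs_apply, RCLike.inner_apply]
  · rw [coeffs, coeffs, LinearIsometryEquiv.inner_map_map, L2.inner_def, L2.inner_def,
      ← integral_re (L2.integrable_inner _ _)]
    apply integral_congr_ae
    filter_upwards [coeFn_complexify u, coeFn_complexify v] with x hx hy
    simp [hx, hy, mul_comm]

theorem hasSum_norm_sq (u : L2 n) : HasSum (fun k => ‖fourierHat u k‖ ^ 2) (‖u‖ ^ 2) := by
  have := hasSum_inner u u
  rw [real_inner_self_eq_norm_sq] at this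
  convert this using 2 with k
  rw [Complex.mul_conj, Complex.ofReal_re, Complex.normSq_eq_norm_sq]

theorem norm_fourierHat_le (u : L2 n) (k : Fin n → ℤ) : ‖fourierHat u k‖ ≤ ‖u‖ := by
  have := le_hasSum (hasSum_norm_sq u) k fun j _ => by positivity
  exact abs_le_of_sq_le_sq' this (norm_nonneg _) |>.2

theorem fourierHat_neg (f : Torus n → ℝ) (k : Fin n → ℤ) :
    fourierHat f (-k) = (starRingEnd ℂ) (fourierHat f k) := by
  rw [fourierHat_eq, fourierHat_eq, ← integral_conj]
  congr 1; funext x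
  rw [map_mul, ← UnitAddTorus.mFourier_neg, Complex.conj_ofReal]

theorem fourierHat_realPart (u : L2C n) (k : Fin n → ℤ) :
    fourierHat (realPart n u) k
      = (UnitAddTorus.mFourierCoeff u k
          + (starRingEnd ℂ) (UnitAddTorus.mFourierCoeff u (-k))) / 2 := by
  rw [fourierHat_congr_ae (coeFn_realPart u), fourierHat_eq, mFourierCoeff_eq, mFourierCoeff_eq,
    ← integral_conj]
  have hu : Integrable u (torusMeasure n) := (Lp.memLp u).integrable (by norm_num)
  have hi : ∀ j : Fin n → ℤ, Integrable (fun t => UnitAddTorus.mFourier j t * u t)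
      (torusMeasure n) := fun j =>
    hu.bdd_mul (c := 1) (UnitAddTorus.mFourier j).continuous.aestronglyMeasurable
      (.of_forall fun x => (ContinuousMap.norm_coe_le_norm _ x).trans UnitAddTorus.mFourier_norm.le)
  rw [← integral_add (hi _), ← integral_div]
  · congr 1; funext x
    rw [map_mul, ← UnitAddTorus.mFourier_neg, neg_neg, ← mul_add, Complex.add_conj]
    push_cast; ring
  · exact Complex.conjLIE.toContinuousLinearEquiv.toContinuousLinearMap.integrable_comp (hi _)

/-! ### Fourier multipliers and their compactness -/

/-- Multiplication by a bounded real sequence on `ℓ²`. -/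
def diag (m : (Fin n → ℤ) → ℝ) {C : ℝ} (hC : 0 ≤ C) (hm : ∀ k, |m k| ≤ C) :
    lp (fun _ : Fin n → ℤ => ℂ) 2 →L[ℝ] lp (fun _ : Fin n → ℤ => ℂ) 2 :=
  lp.mapCLM 2 (fun k => m k • ContinuousLinearMap.id ℝ ℂ) hC fun k => by
    rw [norm_smul]
    exact (mul_le_of_le_one_right (norm_nonneg _) ContinuousLinearMap.norm_id_le).trans (hm k)

theorem diag_apply (m : (Fin n → ℤ) → ℝ) {C : ℝ} (hC : 0 ≤ C) (hm : ∀ k, |m k| ≤ C)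
    (a : lp (fun _ : Fin n → ℤ => ℂ) 2) (k : Fin n → ℤ) : diag m hC hm a k = m k * a k := by
  simp [diag]

/-- The finite-rank truncations `P S` converge in operator norm, since the error is at most the
supremum of |m| off `S`. -/
theorem isCompactOperator_diag (m : (Fin n → ℤ) → ℝ) {C : ℝ} (hC : 0 ≤ C) (hm : ∀ k, |m k| ≤ C)
    (h0 : Filter.Tendsto m Filter.cofinite (nhds 0)) : IsCompactOperator (diag m hC hm) := by
  classical
  let P : Finset (Fin n → ℤ) →
      lp (fun _ : Fin n → ℤ => ℂ) 2 →L[ℝ] lp (fun _ : Fin n → ℤ => ℂ) 2 := fun S =>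
    ∑ k ∈ S, (lp.singleContinuousLinearMap ℝ (fun _ : Fin n → ℤ => ℂ) 2 k).comp
      (m k • (lp.evalCLM ℝ (fun _ : Fin n → ℤ => ℂ) 2 k))
  have hP : ∀ S, IsCompactOperator (P S) := fun S =>
    Submodule.sum_mem (compactOperator (RingHom.id ℝ) _ _) fun k _ =>
      (isCompactOperator_of_locallyCompactSpace_rng
        (lp.singleContinuousLinearMap ℝ (fun _ : Fin n → ℤ => ℂ) 2 k)).comp_clm _
  have hPapp : ∀ S a k, P S a k = if k ∈ S then (m k : ℂ) * a k else 0 := by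
    intro S a k
    simp only [P, sum_apply, lp.coeFn_sum, Finset.sum_apply,
      ContinuousLinearMap.comp_apply, lp.singleContinuousLinearMap_apply, lp.single_apply]
    rw [Finset.sum_pi_single]
    simp
    rfl
  refine isCompactOperator_of_tendsto (l := Filter.atTop) (F := P) ?_ (.of_forall hP)
  rw [Metric.tendsto_atTop]
  intro ε hε
  have hfin := (Metric.tendsto_nhds.mp h0 (ε / 2) (by positivity))
  rw [Filter.eventually_cofinite] at hfin
  refine ⟨hfin.toFinset, fun S hS => ?_⟩
  rw [dist_comm, dist_eq_norm]
  refine lt_of_le_of_lt (ContinuousLinearMap.opNorm_le_bound _ (half_pos hε).le fun a => ?_)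
    (half_lt_self hε)
  rw [← Real.norm_of_nonneg (half_pos hε).le, ← norm_smul]
  refine lp.norm_mono two_ne_zero fun k => ?_
  rw [sub_apply, lp.coeFn_sub, Pi.sub_apply, diag_apply, hPapp]
  split_ifs with hk
  · simpa using by positivity
  · have : |m k| < ε / 2 := by
      by_contra hcon
      exact hk (hS (by simpa using hcon))
    rw [sub_zero, lp.coeFn_smul, Pi.smul_apply, norm_smul, norm_mul, Complex.norm_real,
      Real.norm_of_nonneg (half_pos hε).le]
    exact mul_le_mul_of_nonneg_right this.le (norm_nonneg _)

/-- The coordinate isometry `L²(Tⁿ; ℂ) ≃ ℓ²` as a real linear map. -/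
def reprReal (n : ℕ) : L2C n →L[ℝ] lp (fun _ : Fin n → ℤ => ℂ) 2 :=
  (fourierBasis n).repr.toContinuousLinearEquiv.toContinuousLinearMap.restrictScalars ℝ

/-- The inverse of `reprReal`. -/
def reprRealSymm (n : ℕ) : lp (fun _ : Fin n → ℤ => ℂ) 2 →L[ℝ] L2C n :=
  (fourierBasis n).repr.symm.toContinuousLinearEquiv.toContinuousLinearMap.restrictScalars ℝ

/-- The real multiplication operator on `L²` with Fourier symbol `m`. -/
def multiplier (m : (Fin n → ℤ) → ℝ) {C : ℝ} (hC : 0 ≤ C) (hm : ∀ k, |m k| ≤ C) :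
    L2 n →L[ℝ] L2 n :=
  (realPart n).comp <| (reprRealSymm n).comp <| (diag m hC hm).comp <|
    (reprReal n).comp (complexify n)

theorem multiplier_apply (m : (Fin n → ℤ) → ℝ) {C : ℝ} (hC : 0 ≤ C) (hm : ∀ k, |m k| ≤ C)
    (u : L2 n) : multiplier m hC hm u
      = realPart n ((fourierBasis n).repr.symm (diag m hC hm (coeffs u))) := rfl

/-- Taking the real part averages the symbol at k and -k, so for an even symbol it changes nothing.
-/
theorem fourierHat_multiplier (m : (Fin n → ℤ) → ℝ) {C : ℝ} (hC : 0 ≤ C) (hm : ∀ k, |m k| ≤ C)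
    (heven : ∀ k, m (-k) = m k) (u : L2 n) (k : Fin n → ℤ) :
    fourierHat (multiplier m hC hm u) k = m k * fourierHat u k := by
  rw [multiplier_apply, fourierHat_realPart]
  simp only [← fourierBasis_repr, LinearIsometryEquiv.apply_symm_apply, diag_apply, coeffs_apply,
    map_mul, heven, fourierHat_neg, Complex.conj_conj, Complex.conj_ofReal]
  ring

theorem isCompactOperator_multiplier (m : (Fin n → ℤ) → ℝ) {C : ℝ} (hC : 0 ≤ C)
    (hm : ∀ k, |m k| ≤ C)
    (h0 : Filter.Tendsto m Filter.cofinite (nhds 0)) : IsCompactOperator (multiplier m hC hm) := by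
  have := isCompactOperator_diag m hC hm h0
  exact ((this.comp_clm ((reprReal n).comp (complexify n))).clm_comp (reprRealSymm n)).clm_comp
    (realPart n)

/-! ### The symbol -/

theorem halfSymbol_nonneg (k : Fin n → ℤ) : 0 ≤ halfSymbol k := by
  unfold halfSymbol; positivity

theorem halfSymbol_neg (k : Fin n → ℤ) : halfSymbol (-k) = halfSymbol k := by
  simp [halfSymbol]

theorem halfSymbol_zero : halfSymbol (0 : Fin n → ℤ) = 0 := by
  simp [halfSymbol]

theorem abs_le_halfSymbol (k : Fin n → ℤ) (i : Fin n) : |(k i : ℝ)| ≤ halfSymbol k := by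
  have h1 : |(k i : ℝ)| ≤ Real.sqrt (∑ i, (k i : ℝ) ^ 2) := by
    rw [← Real.sqrt_sq_eq_abs]
    exact Real.sqrt_le_sqrt
      (Finset.single_le_sum (f := fun i => (k i : ℝ) ^ 2) (fun _ _ => sq_nonneg _) (Finset.mem_univ i))
  have h2 : (1 : ℝ) ≤ 2 * Real.pi := by linarith [Real.pi_gt_three]
  unfold halfSymbol
  nlinarith [Real.sqrt_nonneg (∑ i, (k i : ℝ) ^ 2)]

theorem one_le_halfSymbol {k : Fin n → ℤ} (hk : k ≠ 0) : 1 ≤ halfSymbol k := by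
  obtain ⟨i, hi⟩ := Function.ne_iff.mp hk
  refine le_trans ?_ (abs_le_halfSymbol k i)
  exact_mod_cast Int.one_le_abs hi

theorem tendsto_halfSymbol :
    Filter.Tendsto (halfSymbol : (Fin n → ℤ) → ℝ) Filter.cofinite Filter.atTop := by
  refine Filter.tendsto_atTop.mpr fun C => ?_
  rw [Filter.eventually_cofinite]
  refine (Set.Finite.pi' fun _ : Fin n => Set.finite_Icc (-⌈C⌉) ⌈C⌉).subset fun k hk i => ?_
  have h := (abs_le_halfSymbol k i).trans (not_le.mp hk).le
  have h' : |k i| ≤ ⌈C⌉ := by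
    have := h.trans (Int.le_ceil C)
    exact_mod_cast this
  exact abs_le.mp h'

/-! ### The resolvent of the half Laplacian -/

theorem abs_inv_add_halfSymbol_le {μ : ℝ} (hμ : 0 < μ) (k : Fin n → ℤ) :
    |(μ + halfSymbol k)⁻¹| ≤ μ⁻¹ := by
  have := halfSymbol_nonneg k
  rw [abs_of_nonneg (by positivity)]
  exact inv_anti₀ hμ (by linarith)

/-- The resolvent `(μ + (-Δ)^{1/2})⁻¹` on `L²(Tⁿ)`. -/
def resolvent {μ : ℝ} (hμ : 0 < μ) : L2 n →L[ℝ] L2 n :=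
  multiplier (fun k => (μ + halfSymbol k)⁻¹) (inv_nonneg.mpr hμ.le) (abs_inv_add_halfSymbol_le hμ)

theorem fourierHat_resolvent {μ : ℝ} (hμ : 0 < μ) (u : L2 n) (k : Fin n → ℤ) :
    fourierHat (resolvent hμ u) k = ((μ + halfSymbol k : ℝ) : ℂ)⁻¹ * fourierHat u k := by
  rw [resolvent, fourierHat_multiplier]
  · push_cast; rfl
  · simp [halfSymbol_neg]

theorem fourierHat_resolvent' {μ : ℝ} (hμ : 0 < μ) (u : L2 n) (k : Fin n → ℤ) :
    ((μ + halfSymbol k : ℝ) : ℂ) * fourierHat (resolvent hμ u) k = fourierHat u k := by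
  rw [fourierHat_resolvent, mul_inv_cancel_left₀]
  have := halfSymbol_nonneg k
  exact Complex.ofReal_ne_zero.mpr (by positivity)

theorem eq_resolvent_iff {μ : ℝ} (hμ : 0 < μ) (u f : L2 n) :
    u = resolvent hμ f ↔
      ∀ k, ((μ + halfSymbol k : ℝ) : ℂ) * fourierHat u k = fourierHat f k := by
  refine ⟨fun h => h ▸ fourierHat_resolvent' hμ f, fun h => ext_fourierHat fun k => ?_⟩
  have := halfSymbol_nonneg k
  have h0 : ((μ + halfSymbol k : ℝ) : ℂ) ≠ 0 := Complex.ofReal_ne_zero.mpr (by positivity)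
  exact mul_left_cancel₀ h0 (by rw [h, fourierHat_resolvent'])

theorem isCompactOperator_resolvent {μ : ℝ} (hμ : 0 < μ) :
    IsCompactOperator (resolvent (n := n) hμ) :=
  isCompactOperator_multiplier _ _ _
    (Filter.Tendsto.inv_tendsto_atTop (Filter.tendsto_atTop_add_const_left _ _ tendsto_halfSymbol))

/-- With s the symbol, μ s ≤ (μ + s)², so the sum is dominated by ‖f‖²/μ. -/
theorem summable_halfSymbol_resolvent {μ : ℝ} (hμ : 0 < μ) (f : L2 n) :
    Summable fun k => halfSymbol k * ‖fourierHat (resolvent hμ f) k‖ ^ 2 := by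
  refine Summable.of_nonneg_of_le (fun k => mul_nonneg (halfSymbol_nonneg k) (sq_nonneg _))
    (fun k => ?_) (((hasSum_norm_sq f).summable).mul_left μ⁻¹)
  have h := halfSymbol_nonneg k
  rw [← fourierHat_resolvent' hμ f, norm_mul, Complex.norm_real, Real.norm_of_nonneg (by positivity),
    mul_pow, ← mul_assoc]
  refine mul_le_mul_of_nonneg_right ?_ (sq_nonneg _)
  rw [inv_mul_eq_div, le_div_iff₀ hμ]
  nlinarith [mul_nonneg hμ.le h]

/-! ### The Lévy measure of the half Laplacian -/

/-- `∫ (1 - cos ⟨v, y⟩) |y|^{-n-1} dy`. -/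
def levyIntegral (v : EuclideanSpace ℝ (Fin n)) : ENNReal :=
  ∫⁻ y : EuclideanSpace ℝ (Fin n),
    ENNReal.ofReal (1 - Real.cos (inner ℝ v y)) * ENNReal.ofReal ((‖y‖ ^ (n + 1))⁻¹)

/-- The kernel and Lebesgue measure are rotation invariant, and a reflection carries v to w. -/
theorem levyIntegral_congr_norm {v w : EuclideanSpace ℝ (Fin n)} (h : ‖v‖ = ‖w‖) :
    levyIntegral v = levyIntegral w := by
  obtain ⟨U, hU⟩ : ∃ U : EuclideanSpace ℝ (Fin n) ≃ₗᵢ[ℝ] EuclideanSpace ℝ (Fin n), U v = w :=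
    ⟨_, Submodule.reflection_sub h⟩
  have := U.measurePreserving.lintegral_comp_emb U.toMeasurableEquiv.measurableEmbedding
    (fun y => ENNReal.ofReal (1 - Real.cos (inner ℝ w y)) * ENNReal.ofReal ((‖y‖ ^ (n + 1))⁻¹))
  rw [levyIntegral, levyIntegral, ← this]
  refine lintegral_congr fun y => ?_
  rw [← hU, LinearIsometryEquiv.inner_map_map, LinearIsometryEquiv.norm_map]

/-- Substituting r y for y, the kernel contributes r^(n+1) and the Jacobian r^(-n). With rotation
invariance this forces the integral to be a multiple of |v|. -/
theorem levyIntegral_smul {r : ℝ} (hr : 0 < r) (v : EuclideanSpace ℝ (Fin n)) :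
    levyIntegral (r • v) = ENNReal.ofReal r * levyIntegral v := by
  have hmap := Measure.map_addHaar_smul
    (volume : Measure (EuclideanSpace ℝ (Fin n))) hr.ne'
  let F : EuclideanSpace ℝ (Fin n) → ENNReal := fun y =>
    ENNReal.ofReal (1 - Real.cos (inner ℝ v y)) * ENNReal.ofReal ((‖y‖ ^ (n + 1))⁻¹)
  have hF : Measurable F := by fun_prop
  have h1 : levyIntegral (r • v) = ∫⁻ y, ENNReal.ofReal (r ^ (n + 1)) * F (r • y) := by
    refine lintegral_congr fun y => ?_
    simp only [F]
    rw [norm_smul, Real.norm_of_nonneg hr.le, real_inner_smul_left, real_inner_smul_right,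
      mul_left_comm, ← ENNReal.ofReal_mul (p := r ^ (n + 1)) (by positivity), mul_pow, mul_inv,
      mul_inv_cancel_left₀ (by positivity)]
  have h2 : ∫⁻ y, F (r • y) = ENNReal.ofReal ((r ^ n)⁻¹) * levyIntegral v := by
    rw [← lintegral_map hF (measurable_const_smul r), hmap, lintegral_smul_measure, smul_eq_mul,
      finrank_euclideanSpace_fin, abs_of_nonneg (by positivity)]
    rfl
  rw [h1, lintegral_const_mul _ (by fun_prop), h2, ← mul_assoc, ← ENNReal.ofReal_mul (by positivity),
    pow_succ', mul_assoc, mul_inv_cancel₀ (by positivity), mul_one]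

theorem levyIntegral_zero : levyIntegral (0 : EuclideanSpace ℝ (Fin n)) = 0 := by
  simp [levyIntegral]

theorem levyIntegral_eq {e : EuclideanSpace ℝ (Fin n)} (he : ‖e‖ = 1)
    (v : EuclideanSpace ℝ (Fin n)) :
    levyIntegral v = ENNReal.ofReal ‖v‖ * levyIntegral e := by
  rcases eq_or_ne v 0 with rfl | hv
  · simp [levyIntegral_zero]
  · rw [← levyIntegral_smul (norm_pos_iff.mpr hv)]
    apply levyIntegral_congr_norm
    rw [norm_smul, he, norm_norm, mul_one]

theorem levyIntegral_ne_top (hn : n ≠ 0) {e : EuclideanSpace ℝ (Fin n)} (he : ‖e‖ = 1) :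
    levyIntegral e ≠ ⊤ := by
  have : Nontrivial (EuclideanSpace ℝ (Fin n)) := ⟨e, 0, by rintro rfl; simp at he⟩
  let g : ℝ → ℝ := fun r => min 2 (r ^ 2 / 2) * (r ^ (n + 1))⁻¹
  have hg0 : ∀ r, 0 ≤ r → 0 ≤ g r := fun r hr => by positivity
  have hg : Integrable (fun y : EuclideanSpace ℝ (Fin n) => g ‖y‖) := by
    rw [integrable_fun_norm_addHaar, finrank_euclideanSpace_fin]
    -- In polar coordinates the integrand is min(2, r²/2)/r². The constant 5/2 is the maximum of
    -- this times 1 + r², attained at r = 2.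
    refine Integrable.mono' ((integrable_inv_one_add_sq.const_mul (5 / 2)).integrableOn) ?_ ?_
    · exact Measurable.aestronglyMeasurable (by simp only [g, smul_eq_mul]; fun_prop)
    · refine (ae_restrict_iff' measurableSet_Ioi).mpr (.of_forall fun r (hr : 0 < r) => ?_)
      rw [smul_eq_mul, Real.norm_of_nonneg (mul_nonneg (by positivity) (hg0 r hr.le))]
      have h1 : r ^ (n - 1) * g r = min 2 (r ^ 2 / 2) * (r ^ 2)⁻¹ := by
        simp only [g]
        obtain ⟨m, rfl⟩ := Nat.exists_eq_succ_of_ne_zero hn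
        simp only [Nat.succ_eq_add_one, Nat.add_sub_cancel]
        field_simp
        ring
      rw [h1, ← div_eq_mul_inv, ← div_eq_mul_inv, div_le_div_iff₀ (by positivity) (by positivity)]
      rcases le_total (r ^ 2) 4 with h4 | h4
      · nlinarith [min_le_right 2 (r ^ 2 / 2), sq_nonneg r]
      · nlinarith [min_le_left 2 (r ^ 2 / 2), sq_nonneg r]
  refine ne_top_of_le_ne_top hg.lintegral_lt_top.ne (lintegral_mono fun y => ?_)
  have h1 : 1 - Real.cos (inner ℝ e y) ≤ min 2 (‖y‖ ^ 2 / 2) := by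
    refine le_min (by linarith [Real.neg_one_le_cos (inner ℝ e y)]) ?_
    have h2 := Real.one_sub_sq_div_two_le_cos (x := inner ℝ e y)
    have h3 := abs_real_inner_le_norm e y
    rw [he, one_mul] at h3
    have h4 := sq_le_sq' (abs_le.mp h3).1 (abs_le.mp h3).2
    linarith
  rw [← ENNReal.ofReal_mul (by linarith [Real.cos_le_one (inner ℝ e y)])]
  exact ENNReal.ofReal_le_ofReal (mul_le_mul_of_nonneg_right h1 (by positivity))

/-- Otherwise cos⟨e, y⟩ = 1 almost everywhere, hence everywhere by continuity, which fails at y =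
πe. -/
theorem levyIntegral_ne_zero {e : EuclideanSpace ℝ (Fin n)} (he : ‖e‖ = 1) :
    levyIntegral e ≠ 0 := by
  have : Nontrivial (EuclideanSpace ℝ (Fin n)) := ⟨e, 0, by rintro rfl; simp at he⟩
  intro h
  rw [levyIntegral, lintegral_eq_zero_iff (by fun_prop)] at h
  have h0 : ∀ᵐ y : EuclideanSpace ℝ (Fin n), y ≠ 0 := by
    simp [ae_iff, measure_singleton]
  have h1 : (fun y : EuclideanSpace ℝ (Fin n) => 1 - Real.cos (inner ℝ e y)) =ᵐ[volume]
      fun _ => 0 := by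
    filter_upwards [h, h0] with y hy hy0
    rw [Pi.zero_apply, mul_eq_zero, ENNReal.ofReal_eq_zero, ENNReal.ofReal_eq_zero] at hy
    rcases hy with hy | hy
    · linarith [Real.cos_le_one (inner ℝ e y)]
    · have : 0 < (‖y‖ ^ (n + 1))⁻¹ := by positivity
      linarith
  have h2 := (Continuous.ae_eq_iff_eq volume (by fun_prop) continuous_const).mp h1
  have h3 := congrFun h2 (Real.pi • e)
  simp only [real_inner_smul_right, real_inner_self_eq_norm_sq, he] at h3
  rw [one_pow, mul_one, Real.cos_pi] at h3
  norm_num at h3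

/-- The frequency `2πk` as a vector. -/
def freq (k : Fin n → ℤ) : EuclideanSpace ℝ (Fin n) :=
  WithLp.toLp 2 fun i => 2 * Real.pi * (k i : ℝ)

theorem norm_freq (k : Fin n → ℤ) : ‖freq k‖ = halfSymbol k := by
  rw [EuclideanSpace.norm_eq, halfSymbol]
  simp only [freq, norm_mul, Real.norm_eq_abs, mul_pow, sq_abs, ← Finset.mul_sum]
  rw [Real.sqrt_mul (by positivity), ← mul_pow, Real.sqrt_sq (by positivity)]

/-- The Lévy–Khintchine representation of the symbol `2π|k|`. -/
theorem exists_levyMeasure (n : ℕ) : ∃ ν : Measure (EuclideanSpace ℝ (Fin n)),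
    ∀ k, ∫⁻ y, ENNReal.ofReal (1 - Real.cos (inner ℝ (freq k) y)) ∂ν
      = ENNReal.ofReal (halfSymbol k) := by
  rcases eq_or_ne n 0 with rfl | hn
  · refine ⟨0, fun k => ?_⟩
    rw [Subsingleton.elim k 0, halfSymbol_zero]
    simp
  · let e : EuclideanSpace ℝ (Fin n) := EuclideanSpace.single ⟨0, Nat.pos_of_ne_zero hn⟩ 1
    have he : ‖e‖ = 1 := by simp [e]
    refine ⟨(levyIntegral e)⁻¹ • volume.withDensity
      fun y => ENNReal.ofReal ((‖y‖ ^ (n + 1))⁻¹), fun k => ?_⟩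
    rw [lintegral_smul_measure, lintegral_withDensity_eq_lintegral_mul _ (by fun_prop)
      (by fun_prop)]
    have : ∫⁻ y, ((fun y : EuclideanSpace ℝ (Fin n) => ENNReal.ofReal ((‖y‖ ^ (n + 1))⁻¹)) *
        fun y => ENNReal.ofReal (1 - Real.cos (inner ℝ (freq k) y))) y
        = levyIntegral (freq k) := lintegral_congr fun y => by
        rw [Pi.mul_apply, mul_comm]
    rw [this, levyIntegral_eq he (freq k), norm_freq, smul_eq_mul, mul_left_comm,
      ENNReal.inv_mul_cancel (levyIntegral_ne_zero he) (levyIntegral_ne_top hn he), mul_one]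

/-! ### Translations -/

/-- The point of the torus represented by a vector. -/
def toTorus (y : EuclideanSpace ℝ (Fin n)) : Torus n := fun i => (y i : UnitAddCircle)

theorem measurePreserving_add (z : Torus n) :
    MeasurePreserving (fun x => x + z) (torusMeasure n) (torusMeasure n) :=
  measurePreserving_add_right _ z

/-- Translation on `L²(Tⁿ)`. -/
def translate (z : Torus n) : L2 n →+ L2 n :=
  Lp.compMeasurePreserving (fun x => x + z) (measurePreserving_add z)

theorem coeFn_translate (z : Torus n) (u : L2 n) :
    translate z u =ᵐ[torusMeasure n] fun x => u (x + z) :=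
  Lp.coeFn_compMeasurePreserving u (measurePreserving_add z)

theorem mFourier_add_point (k : Fin n → ℤ) (x z : Torus n) :
    UnitAddTorus.mFourier k (x + z) = UnitAddTorus.mFourier k x * UnitAddTorus.mFourier k z := by
  simp [UnitAddTorus.mFourier, fourier_apply, smul_add, AddCircle.toCircle_add,
    Finset.prod_mul_distrib]

theorem mFourier_toTorus (k : Fin n → ℤ) (y : EuclideanSpace ℝ (Fin n)) :
    UnitAddTorus.mFourier k (toTorus y) = Complex.exp ((inner ℝ (freq k) y : ℝ) * Complex.I) := by
  simp only [UnitAddTorus.mFourier, toTorus, ContinuousMap.coe_mk, fourier_coe_apply,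
    ← Complex.exp_sum]
  congr 1
  simp only [PiLp.inner_apply, freq, RCLike.inner_apply, conj_trivial]
  push_cast
  rw [Finset.sum_mul]
  refine Finset.sum_congr rfl fun i _ => ?_
  ring

theorem norm_mFourier_apply (k : Fin n → ℤ) (x : Torus n) : ‖UnitAddTorus.mFourier k x‖ = 1 := by
  simp only [UnitAddTorus.mFourier, fourier_apply, ContinuousMap.coe_mk, norm_prod,
    Circle.norm_coe, Finset.prod_const_one]

theorem fourierHat_translate (z : Torus n) (u : L2 n) (k : Fin n → ℤ) :
    fourierHat (translate z u) k = UnitAddTorus.mFourier k z * fourierHat u k := by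
  rw [fourierHat_congr_ae (coeFn_translate z u), fourierHat_eq, fourierHat_eq,
    ← integral_add_right_eq_self (μ := torusMeasure n)
      (fun t => UnitAddTorus.mFourier (-k) t * (u t : ℂ)) z,
    ← integral_const_mul]
  congr 1; funext x
  have h : UnitAddTorus.mFourier k z * UnitAddTorus.mFourier (-k) z = 1 := by
    rw [UnitAddTorus.mFourier_neg, Complex.mul_conj, Complex.normSq_eq_norm_sq,
      norm_mFourier_apply]
    simp
  rw [mFourier_add_point]
  linear_combination -(UnitAddTorus.mFourier (-k) x * (u (x + z) : ℂ)) * h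

theorem norm_sq_exp_sub_one (t : ℝ) :
    ‖Complex.exp (t * Complex.I) - 1‖ ^ 2 = 2 * (1 - Real.cos t) := by
  rw [← Complex.normSq_eq_norm_sq, Complex.normSq_apply]
  simp only [Complex.sub_re, Complex.sub_im, Complex.exp_ofReal_mul_I_re,
    Complex.exp_ofReal_mul_I_im, Complex.one_re, Complex.one_im]
  nlinarith [Real.sin_sq_add_cos_sq t]

theorem hasSum_translate_sub (y : EuclideanSpace ℝ (Fin n)) (u : L2 n) :
    HasSum (fun k => 2 * (1 - Real.cos (inner ℝ (freq k) y)) * ‖fourierHat u k‖ ^ 2)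
      (‖translate (toTorus y) u - u‖ ^ 2) := by
  convert hasSum_norm_sq (translate (toTorus y) u - u) using 2 with k
  rw [fourierHat_sub, fourierHat_translate, mFourier_toTorus, ← sub_one_mul, norm_mul, mul_pow,
    norm_sq_exp_sub_one]

/-- The pointwise reverse triangle inequality; through the Lévy representation it becomes the
contraction property of the seminorm. -/
theorem norm_translate_abs_sub_le (z : Torus n) (u : L2 n) :
    ‖translate z |u| - |u|‖ ≤ ‖translate z u - u‖ := by
  have h1 := (measurePreserving_add z).quasiMeasurePreserving.ae (Lp.coeFn_abs u)
  apply Lp.norm_le_norm_of_ae_le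
  filter_upwards [Lp.coeFn_sub (translate z |u|) |u|, Lp.coeFn_sub (translate z u) u,
    coeFn_translate z u, coeFn_translate z |u|, Lp.coeFn_abs u, h1] with x h1 h2 h3 h4 h5 h6
  rw [h1, h2, Pi.sub_apply, Pi.sub_apply, h3, h4, h5, h6]
  exact abs_abs_sub_abs_le _ _

/-- The `H^{1/2}` seminorm squared, as an extended nonnegative number. -/
def energyForm (u : L2 n) : ENNReal :=
  ∑' k, ENNReal.ofReal (halfSymbol k * ‖fourierHat u k‖ ^ 2)

/-- Parseval expands each translation difference into factors 1 - cos; Tonelli then integrates them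
to the symbol. -/
theorem energyForm_eq_lintegral {ν : Measure (EuclideanSpace ℝ (Fin n))}
    (hν : ∀ k, ∫⁻ y, ENNReal.ofReal (1 - Real.cos (inner ℝ (freq k) y)) ∂ν
      = ENNReal.ofReal (halfSymbol k)) (u : L2 n) :
    energyForm u = ∫⁻ y, ENNReal.ofReal (‖translate (toTorus y) u - u‖ ^ 2 / 2) ∂ν := by
  have h : ∀ y, ENNReal.ofReal (‖translate (toTorus y) u - u‖ ^ 2 / 2)
      = ∑' k, ENNReal.ofReal (1 - Real.cos (inner ℝ (freq k) y))
          * ENNReal.ofReal (‖fourierHat u k‖ ^ 2) := by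
    intro y
    have h1 := (hasSum_translate_sub y u).div_const 2
    have h0 : ∀ k, 0 ≤ 2 * (1 - Real.cos (inner ℝ (freq k) y)) * ‖fourierHat u k‖ ^ 2 / 2 := by
      intro k
      have := Real.cos_le_one (inner ℝ (freq k) y)
      have : 0 ≤ 1 - Real.cos (inner ℝ (freq k) y) := by linarith
      positivity
    rw [← h1.tsum_eq, ENNReal.ofReal_tsum_of_nonneg h0 h1.summable]
    refine tsum_congr fun k => ?_
    rw [← ENNReal.ofReal_mul (by linarith [Real.cos_le_one (inner ℝ (freq k) y)])]
    congr 1; ring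
  simp only [h]
  rw [lintegral_tsum fun k => by fun_prop]
  refine tsum_congr fun k => ?_
  rw [lintegral_mul_const _ (by fun_prop), hν, ENNReal.ofReal_mul (halfSymbol_nonneg k)]

/-- The seminorm does not increase under `u ↦ |u|`. -/
theorem energyForm_abs_le (u : L2 n) : energyForm |u| ≤ energyForm u := by
  obtain ⟨ν, hν⟩ := exists_levyMeasure n
  rw [energyForm_eq_lintegral hν, energyForm_eq_lintegral hν]
  refine lintegral_mono fun y => ENNReal.ofReal_le_ofReal ?_
  have := norm_translate_abs_sub_le (toTorus y) u
  gcongr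

theorem energyForm_ne_top_iff (u : L2 n) :
    energyForm u ≠ ⊤ ↔ Summable fun k => halfSymbol k * ‖fourierHat u k‖ ^ 2 := by
  have h0 : ∀ k, 0 ≤ halfSymbol k * ‖fourierHat u k‖ ^ 2 := fun k =>
    mul_nonneg (halfSymbol_nonneg k) (sq_nonneg _)
  refine ⟨fun h => ?_, fun h => h.tsum_ofReal_ne_top⟩
  have := ENNReal.summable_toReal h
  simpa only [ENNReal.toReal_ofReal (h0 _)] using this

/-- `u ↦ |u|` preserves `H^{1/2}` and does not increase the seminorm. -/
theorem tsum_abs_le {u : L2 n} (h : Summable fun k => halfSymbol k * ‖fourierHat u k‖ ^ 2) :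
    (Summable fun k => halfSymbol k * ‖fourierHat (|u| : L2 n) k‖ ^ 2) ∧
      ∑' k, halfSymbol k * ‖fourierHat (|u| : L2 n) k‖ ^ 2
        ≤ ∑' k, halfSymbol k * ‖fourierHat u k‖ ^ 2 := by
  have h0 : ∀ (v : L2 n) k, 0 ≤ halfSymbol k * ‖fourierHat v k‖ ^ 2 := fun v k =>
    mul_nonneg (halfSymbol_nonneg k) (sq_nonneg _)
  have hle := energyForm_abs_le u
  have hu := (energyForm_ne_top_iff u).mpr h
  have ha := (energyForm_ne_top_iff |u|).mp (ne_top_of_le_ne_top hu hle)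
  refine ⟨ha, ?_⟩
  rw [energyForm, energyForm, ← ENNReal.ofReal_tsum_of_nonneg (h0 _) ha,
    ← ENNReal.ofReal_tsum_of_nonneg (h0 _) h] at hle
  exact (ENNReal.ofReal_le_ofReal_iff (tsum_nonneg (h0 _))).mp hle

/-! ### Positivity of the resolvent -/

theorem norm_abs_eq (u : L2 n) : ‖|u|‖ = ‖u‖ := norm_abs_eq_norm u

theorem inner_le_inner_abs {f : L2 n} (hf : 0 ≤ f) (u : L2 n) :
    inner ℝ f u ≤ inner ℝ f |u| := by
  rw [L2.inner_def, L2.inner_def]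
  refine integral_mono_ae (L2.integrable_inner _ _) (L2.integrable_inner _ _) ?_
  filter_upwards [Lp.coeFn_abs u, (Lp.coeFn_nonneg f).mpr hf] with x hx hfx
  simp only [RCLike.inner_apply, conj_trivial, hx]
  exact mul_le_mul_of_nonneg_right (le_abs_self _) hfx

/-- The resolvent is characterized by minimality of the quadratic functional. -/
theorem resolvent_eq_of_le {μ : ℝ} (hμ : 0 < μ) (f v : L2 n)
    (hv : Summable fun k => halfSymbol k * ‖fourierHat v k‖ ^ 2)
    (h : ∑' k, halfSymbol k * ‖fourierHat v k‖ ^ 2 + μ * ‖v‖ ^ 2 - 2 * inner ℝ f v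
      ≤ ∑' k, halfSymbol k * ‖fourierHat (resolvent hμ f) k‖ ^ 2 + μ * ‖resolvent hμ f‖ ^ 2
        - 2 * inner ℝ f (resolvent hμ f)) : v = resolvent hμ f := by
  set u := resolvent hμ f with hu
  have hsu := summable_halfSymbol_resolvent hμ f
  have hV := (hv.hasSum.add ((hasSum_norm_sq v).mul_left μ)).sub ((hasSum_inner f v).mul_left 2)
  have hU := (hsu.hasSum.add ((hasSum_norm_sq u).mul_left μ)).sub ((hasSum_inner f u).mul_left 2)
  have hD := (hasSum_norm_sq (v - u)).mul_left μ
  -- Since f̂ = (μ + s)û, completing the square makes the right side (μ + s)|v̂ - û|²; summing gives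
  -- strict convexity of the functional.
  have key : ∀ k, μ * ‖fourierHat (v - u : L2 n) k‖ ^ 2 ≤
      (halfSymbol k * ‖fourierHat v k‖ ^ 2 + μ * ‖fourierHat v k‖ ^ 2
        - 2 * (fourierHat f k * (starRingEnd ℂ) (fourierHat v k)).re)
      - (halfSymbol k * ‖fourierHat u k‖ ^ 2 + μ * ‖fourierHat u k‖ ^ 2
        - 2 * (fourierHat f k * (starRingEnd ℂ) (fourierHat u k)).re) := by
    intro k
    rw [fourierHat_sub, ← fourierHat_resolvent' hμ f k, ← hu]
    have hs := halfSymbol_nonneg k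
    generalize fourierHat v k = a
    generalize fourierHat u k = b
    simp only [← Complex.normSq_eq_norm_sq, Complex.normSq_apply, Complex.mul_re, Complex.mul_im,
      Complex.conj_re, Complex.conj_im, Complex.ofReal_re, Complex.ofReal_im, Complex.sub_re,
      Complex.sub_im]
    nlinarith [mul_nonneg hs (sq_nonneg (a.re - b.re)), mul_nonneg hs (sq_nonneg (a.im - b.im))]
  have h1 := hasSum_le key hD (hV.sub hU)
  have h2 : μ * ‖v - u‖ ^ 2 ≤ 0 := by linarith
  have h3 : ‖v - u‖ ^ 2 ≤ 0 := by
    by_contra hcon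
    push Not at hcon
    have := mul_pos hμ hcon
    linarith
  have h4 : ‖v - u‖ = 0 := by nlinarith [norm_nonneg (v - u)]
  exact sub_eq_zero.mp (norm_eq_zero.mp h4)

/-- For f ≥ 0, replacing the minimiser u by |u| does not increase the functional, so uniqueness
gives |u| = u. -/
theorem resolvent_nonneg {μ : ℝ} (hμ : 0 < μ) {f : L2 n} (hf : 0 ≤ f) : 0 ≤ resolvent hμ f := by
  have h := tsum_abs_le (summable_halfSymbol_resolvent hμ f)
  rw [← resolvent_eq_of_le hμ f |resolvent hμ f| h.1]
  · exact abs_nonneg _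
  · rw [norm_abs_eq]
    linarith [h.2, inner_le_inner_abs hf (resolvent hμ f)]

theorem resolvent_mono {μ : ℝ} (hμ : 0 < μ) {f g : L2 n} (h : f ≤ g) :
    resolvent hμ f ≤ resolvent hμ g := by
  rw [← sub_nonneg, ← map_sub]
  exact resolvent_nonneg hμ (sub_nonneg.mpr h)

/-! ### Constants -/

/-- The constant function in `L²`. -/
def constL2 (n : ℕ) (c : ℝ) : L2 n := Lp.const 2 (torusMeasure n) c

theorem coeFn_constL2 (c : ℝ) : constL2 n c =ᵐ[torusMeasure n] fun _ => c :=
  Lp.coeFn_const 2 (torusMeasure n) c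

theorem constL2_sub (a b : ℝ) : constL2 n (a - b) = constL2 n a - constL2 n b :=
  map_sub (Lp.const 2 (torusMeasure n)) a b

theorem norm_constL2 (c : ℝ) : ‖constL2 n c‖ = |c| := by
  rw [constL2, Lp.norm_const] <;> simp

theorem mFourierCoeff_one (k : Fin n → ℤ) :
    UnitAddTorus.mFourierCoeff (fun _ : Torus n => (1 : ℂ)) k = if k = 0 then 1 else 0 := by
  classical
  have h1 := fourierBasis_repr (fourierBasis n 0) k
  rw [HilbertBasis.repr_self, lp.single_apply, Pi.single_apply] at h1
  rw [h1]
  have h2 : fourierBasis n 0 = UnitAddTorus.mFourierLp 2 0 :=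
    congrFun UnitAddTorus.coe_mFourierBasis 0
  rw [h2]
  refine congrFun (mFourierCoeff_congr_ae ?_) k
  filter_upwards [UnitAddTorus.coeFn_mFourierLp (d := Fin n) 2 0] with x hx
  rw [hx, UnitAddTorus.mFourier_zero, ContinuousMap.one_apply]

theorem fourierHat_const (c : ℝ) (k : Fin n → ℤ) :
    fourierHat (constL2 n c) k = if k = 0 then (c : ℂ) else 0 := by
  have h := mFourierCoeff_one k
  rw [mFourierCoeff_eq] at h
  rw [fourierHat_congr_ae (coeFn_constL2 c), fourierHat_eq, integral_mul_const]
  simp only [mul_one] at h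
  rw [h]
  split_ifs <;> simp

theorem resolvent_const {μ : ℝ} (hμ : 0 < μ) (c : ℝ) :
    resolvent hμ (constL2 n c) = constL2 n (c / μ) := by
  symm
  rw [eq_resolvent_iff]
  intro k
  rw [fourierHat_const, fourierHat_const]
  split_ifs with h
  · rw [h, halfSymbol_zero, add_zero, Complex.ofReal_div,
      mul_div_cancel₀ _ (Complex.ofReal_ne_zero.mpr hμ.ne')]
  · simp

/-- The resolvent is bounded by `1/μ` for the essential supremum norm. -/
theorem abs_resolvent_le {μ : ℝ} (hμ : 0 < μ) {f : L2 n} {B : ℝ}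
    (hf : ∀ᵐ x ∂(torusMeasure n), |f x| ≤ B) :
    ∀ᵐ x ∂(torusMeasure n), |resolvent hμ f x| ≤ B / μ := by
  have h1 : f ≤ constL2 n B := by
    rw [← Lp.coeFn_le]
    filter_upwards [hf, coeFn_constL2 B] with x hx hc
    rw [hc]; exact (abs_le.mp hx).2
  have h2 : constL2 n (-B) ≤ f := by
    rw [← Lp.coeFn_le]
    filter_upwards [hf, coeFn_constL2 (-B)] with x hx hc
    rw [hc]; exact (abs_le.mp hx).1
  have h3 := resolvent_mono hμ h1
  have h4 := resolvent_mono hμ h2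
  rw [resolvent_const, ← Lp.coeFn_le] at h3 h4
  filter_upwards [h3, h4, coeFn_constL2 (B / μ), coeFn_constL2 (-B / μ)] with x a b c d
  rw [c] at a
  rw [d, neg_div] at b
  exact abs_le.mpr ⟨b, a⟩

/-! ### Continuous representatives -/

/-- The subspace of classes in `L²` with a continuous representative. -/
def continuousL2 (n : ℕ) : Submodule ℝ (L2 n) :=
  LinearMap.range (ContinuousMap.toLp 2 (torusMeasure n) ℝ : C(Torus n, ℝ) →L[ℝ] L2 n).toLinearMap

theorem mem_continuousL2 {u : L2 n} :
    u ∈ continuousL2 n ↔ ∃ c : C(Torus n, ℝ), u =ᵐ[torusMeasure n] c := by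
  constructor
  · rintro ⟨c, rfl⟩
    exact ⟨c, ContinuousMap.coeFn_toLp _ c⟩
  · rintro ⟨c, hc⟩
    exact ⟨c, Lp.ext ((ContinuousMap.coeFn_toLp _ c).trans hc.symm)⟩

theorem exists_bound_of_mem_continuousL2 {u : L2 n} (hu : u ∈ continuousL2 n) :
    ∃ B, ∀ᵐ x ∂(torusMeasure n), |u x| ≤ B := by
  obtain ⟨c, hc⟩ := mem_continuousL2.mp hu
  exact ⟨‖c‖, hc.mono fun x hx => hx ▸ c.norm_coe_le_norm x⟩

theorem mem_continuousL2_of_summable {u : L2 n} (h : Summable fun k => ‖fourierHat u k‖) :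
    u ∈ continuousL2 n := by
  have hs : Summable fun k => fourierHat u k • (UnitAddTorus.mFourier k : C(Torus n, ℂ)) := by
    refine Summable.of_norm ?_
    simpa only [norm_smul, UnitAddTorus.mFourier_norm, mul_one] using h
  set c := ∑' k, fourierHat u k • (UnitAddTorus.mFourier k : C(Torus n, ℂ)) with hc
  have h1 := hs.hasSum.mapL (ContinuousMap.toLp 2 (torusMeasure n) ℂ : C(Torus n, ℂ) →L[ℂ] L2C n)
  have h2 := UnitAddTorus.hasSum_mFourier_series_L2 (complexify n u)
  have h3 : ∀ k, UnitAddTorus.mFourierCoeff (complexify n u) k = fourierHat u k := fun k =>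
    congrFun (mFourierCoeff_congr_ae (coeFn_complexify u)) k
  simp only [h3] at h2
  simp only [map_smul] at h1
  have h4 : (ContinuousMap.toLp 2 (torusMeasure n) ℂ : C(Torus n, ℂ) →L[ℂ] L2C n) c
      = complexify n u := h1.unique h2
  refine mem_continuousL2.mpr ⟨⟨fun x => (c x).re, by fun_prop⟩, ?_⟩
  have h5 := ContinuousMap.coeFn_toLp (p := 2) (𝕜 := ℂ) (torusMeasure n) c
  rw [h4] at h5
  filter_upwards [h5, coeFn_complexify u] with x hx hy
  rw [hy] at hx
  rw [ContinuousMap.coe_mk, ← hx, Complex.ofReal_re]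

theorem ae_le_iff_forall {f g : Torus n → ℝ} (hf : Continuous f) (hg : Continuous g) :
    (∀ᵐ x ∂(torusMeasure n), f x ≤ g x) ↔ ∀ x, f x ≤ g x := by
  refine ⟨fun h x => ?_, fun h => .of_forall h⟩
  have hd := Measure.dense_of_ae h
  have hc : IsClosed {x | f x ≤ g x} := isClosed_le hf hg
  have : {x | f x ≤ g x} = Set.univ := hc.closure_eq ▸ hd.closure_eq
  have hx : x ∈ {x | f x ≤ g x} := by rw [this]; trivial
  exact hx

/-- Haar measure charges every nonempty open set, so for continuous functions almost everywhere
bounds are uniform bounds and the approximants are Cauchy in C(Tⁿ). -/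
theorem mem_continuousL2_of_approx {u : L2 n}
    (h : ∀ ε > 0, ∃ v ∈ continuousL2 n, ∀ᵐ x ∂(torusMeasure n), |u x - v x| ≤ ε) :
    u ∈ continuousL2 n := by
  have h' : ∀ m : ℕ, ∃ c : C(Torus n, ℝ),
      ∀ᵐ x ∂(torusMeasure n), |u x - c x| ≤ 1 / ((m : ℝ) + 1) := by
    intro m
    obtain ⟨v, hv, hvu⟩ := h (1 / ((m : ℝ) + 1)) (by positivity)
    obtain ⟨c, hc⟩ := mem_continuousL2.mp hv
    refine ⟨c, ?_⟩
    filter_upwards [hc, hvu] with x hx hy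
    rwa [hx] at hy
  choose c hc using h'
  have hdist : ∀ m l N : ℕ, N ≤ m → N ≤ l → dist (c m) (c l) ≤ 2 * (1 / ((N : ℝ) + 1)) := by
    intro m l N hm hl
    rw [ContinuousMap.dist_le (by positivity)]
    rw [← ae_le_iff_forall (by fun_prop) (by fun_prop)]
    filter_upwards [hc m, hc l] with x h1 h2
    rw [Real.dist_eq]
    have h3 : c m x - c l x = (u x - c l x) - (u x - c m x) := by ring
    have h4 := Nat.one_div_le_one_div (α := ℝ) hm
    have h5 := Nat.one_div_le_one_div (α := ℝ) hl
    rw [h3]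
    refine (abs_sub _ _).trans ?_
    linarith
  have hzero : Filter.Tendsto (fun N : ℕ => 2 * (1 / ((N : ℝ) + 1))) Filter.atTop (nhds 0) := by
    simpa using tendsto_one_div_add_atTop_nhds_zero_nat.const_mul (2 : ℝ)
  have hcau : CauchySeq c :=
    cauchySeq_of_le_tendsto_0 _ (fun m l N hm hl => hdist m l N hm hl) hzero
  obtain ⟨d, hd⟩ := cauchySeq_tendsto_of_complete hcau
  refine mem_continuousL2.mpr ⟨d, ?_⟩
  filter_upwards [ae_all_iff.mpr hc] with x hx
  have h1 : Filter.Tendsto (fun m => c m x) Filter.atTop (nhds (d x)) :=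
    ((ContinuousEvalConst.continuous_eval_const x).tendsto d).comp hd
  have h2 : Filter.Tendsto (fun m => c m x) Filter.atTop (nhds (u x)) := by
    rw [tendsto_iff_dist_tendsto_zero]
    refine squeeze_zero (fun _ => dist_nonneg) (fun m => ?_)
      tendsto_one_div_add_atTop_nhds_zero_nat
    rw [dist_comm, Real.dist_eq]
    exact hx m
  exact tendsto_nhds_unique h2 h1

/-! ### Smoothing by iterated resolvents -/

theorem summable_prod_pi {ι α : Type*} [Fintype ι] {f : α → ℝ} (hf : Summable f)
    (h0 : ∀ a, 0 ≤ f a) : Summable fun k : ι → α => ∏ i, f (k i) := by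
  classical
  refine summable_of_sum_le (c := ∏ _i : ι, ∑' a, f a)
    (fun k => Finset.prod_nonneg fun i _ => h0 _) fun s => ?_
  calc ∑ k ∈ s, ∏ i, f (k i)
      ≤ ∑ k ∈ Fintype.piFinset fun i => s.image fun k => k i, ∏ i, f (k i) := by
        refine Finset.sum_le_sum_of_subset_of_nonneg (fun k hk => ?_)
          fun k _ _ => Finset.prod_nonneg fun i _ => h0 _
        rw [Fintype.mem_piFinset]
        exact fun i => Finset.mem_image_of_mem _ hk
    _ = ∏ i, ∑ a ∈ s.image fun k => k i, f a := by
        rw [Finset.prod_univ_sum]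
    _ ≤ ∏ _i : ι, ∑' a, f a :=
        Finset.prod_le_prod (fun i _ => Finset.sum_nonneg fun a _ => h0 a)
          fun i _ => hf.sum_le_tsum _ fun a _ => h0 a

theorem summable_int_inv_sq : Summable fun a : ℤ => ((1 + |(a : ℝ)|) ^ 2)⁻¹ := by
  have h1 : Summable fun a : ℤ => 1 / (a : ℝ) ^ 2 :=
    Real.summable_one_div_int_pow.mpr one_lt_two
  have h2 : Summable fun a : ℤ => if a = 0 then (1 : ℝ) else 0 := (hasSum_ite_eq 0 1).summable
  refine Summable.of_nonneg_of_le (fun a => by positivity) (fun a => ?_) (h1.add h2)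
  rcases eq_or_ne a 0 with rfl | ha
  · simp
  · have h3 : 0 < |(a : ℝ)| := abs_pos.mpr (Int.cast_ne_zero.mpr ha)
    rw [if_neg ha, add_zero, ← sq_abs (a : ℝ), one_div]
    gcongr
    linarith

/-- Each of the n factors is bounded using a different coordinate of k, so the square is dominated
by a product of one-dimensional summable sequences. This is why n resolvents suffice to reach
absolutely summable Fourier coefficients. -/
theorem summable_resolvent_symbol {μ : ℝ} (hμ : 0 < μ) :
    Summable fun k : Fin n → ℤ => ((μ + halfSymbol k)⁻¹ ^ n) ^ 2 := by
  set c := min μ 1 with hc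
  have hc0 : 0 < c := lt_min hμ one_pos
  refine Summable.of_nonneg_of_le (fun k => by positivity) (fun k => ?_)
    ((summable_prod_pi (ι := Fin n) summable_int_inv_sq fun a => by positivity).mul_left
      ((c⁻¹ ^ n) ^ 2))
  have h1 : ∀ i, (μ + halfSymbol k)⁻¹ ≤ c⁻¹ * (1 + |(k i : ℝ)|)⁻¹ := by
    intro i
    rw [← mul_inv]
    refine inv_anti₀ (by positivity) ?_
    have := abs_le_halfSymbol k i
    have h2 : c * |(k i : ℝ)| ≤ |(k i : ℝ)| :=
      mul_le_of_le_one_left (abs_nonneg _) (min_le_right _ _)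
    have h3 : c ≤ μ := min_le_left _ _
    linarith
  have h2 : (μ + halfSymbol k)⁻¹ ^ n ≤ c⁻¹ ^ n * ∏ i, (1 + |(k i : ℝ)|)⁻¹ := by
    have := Finset.prod_le_prod (s := Finset.univ) (fun i _ => ?_) fun i (_ : i ∈ Finset.univ) => h1 i
    · simpa [Finset.prod_mul_distrib] using this
    · have := halfSymbol_nonneg k
      positivity
  have h3 := pow_le_pow_left₀ (by have := halfSymbol_nonneg k; positivity) h2 2
  rw [mul_pow, ← Finset.prod_pow] at h3
  simpa only [inv_pow] using h3

theorem fourierHat_resolvent_iterate {μ : ℝ} (hμ : 0 < μ) (f : L2 n) (j : ℕ) (k : Fin n → ℤ) :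
    fourierHat ((resolvent hμ)^[j] f) k
      = (((μ + halfSymbol k)⁻¹ ^ j : ℝ) : ℂ) * fourierHat f k := by
  induction j with
  | zero => simp
  | succ j ih =>
    rw [Function.iterate_succ_apply', fourierHat_resolvent, ih]
    push_cast
    ring

theorem resolvent_iterate_mem_continuousL2 {μ : ℝ} (hμ : 0 < μ) (f : L2 n) :
    (resolvent hμ)^[n] f ∈ continuousL2 n := by
  refine mem_continuousL2_of_summable ?_
  refine Summable.of_nonneg_of_le (fun k => norm_nonneg _) (fun k => ?_)
    ((summable_resolvent_symbol hμ).add (hasSum_norm_sq f).summable)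
  have h := halfSymbol_nonneg k
  rw [fourierHat_resolvent_iterate, norm_mul, Complex.norm_real, Real.norm_of_nonneg (by positivity)]
  nlinarith [sq_nonneg ((μ + halfSymbol k)⁻¹ ^ n - ‖fourierHat f k‖),
    sq_nonneg ((μ + halfSymbol k)⁻¹ ^ n), sq_nonneg ‖fourierHat f k‖]

/-- The first resolvent equation. -/
theorem resolvent_eq_resolvent {l μ : ℝ} (hl : 0 < l) (hμ : 0 < μ) (f : L2 n) :
    resolvent hl f = resolvent hμ (f - l • resolvent hl f + μ • resolvent hl f) := by
  rw [eq_resolvent_iff]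
  intro k
  rw [fourierHat_add, fourierHat_sub, fourierHat_smul, fourierHat_smul,
    ← fourierHat_resolvent' hl f k]
  push_cast
  ring

/-- The resolvent maps bounded functions to continuous functions. -/
theorem resolvent_mem_continuousL2 {l : ℝ} (hl : 0 < l) {f : L2 n} {B : ℝ}
    (hf : ∀ᵐ x ∂(torusMeasure n), |f x| ≤ B) : resolvent hl f ∈ continuousL2 n := by
  have hB : 0 ≤ B := by
    obtain ⟨x, hx⟩ := hf.exists
    exact (abs_nonneg _).trans hx
  set u := resolvent hl f with hu
  have hub := abs_resolvent_le hl hf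
  refine mem_continuousL2_of_approx fun ε hε => ?_
  -- Approximate u by (μR_μ)ⁿu: each of the n factors costs at most 2B/μ in the supremum norm. The
  -- added 1 keeps μ positive when n or B is 0.
  set μ := n * (2 * B) / ε + 1 with hμdef
  have hμ : 0 < μ := by positivity
  have hiter : ∀ j : ℕ, (fun v => μ • resolvent hμ v)^[j] u = μ ^ j • (resolvent hμ)^[j] u := by
    intro j
    induction j with
    | zero => simp
    | succ j ih =>
      rw [Function.iterate_succ_apply', Function.iterate_succ_apply', ih, map_smul, smul_smul,
        pow_succ']
  have hstep : ∀ᵐ x ∂(torusMeasure n), |(u - μ • resolvent hμ u : L2 n) x| ≤ 2 * B / μ := by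
    have h1 : u - μ • resolvent hμ u = resolvent hμ (f - l • u) := by
      have := resolvent_eq_resolvent hl hμ f
      rw [map_add, map_smul] at this
      rw [← hu] at this
      exact sub_eq_iff_eq_add.mpr this
    rw [h1]
    apply abs_resolvent_le hμ
    filter_upwards [hf, hub, Lp.coeFn_sub f (l • u), Lp.coeFn_smul l u] with x h2 h3 h4 h5
    rw [h4, Pi.sub_apply, h5, Pi.smul_apply, smul_eq_mul]
    refine (abs_sub _ _).trans ?_
    rw [abs_mul, abs_of_pos hl]
    rw [le_div_iff₀ hl] at h3
    linarith
  -- With T = μR_μ, a supremum-norm contraction, u - T^(j+1)u = (u - Tu) + T(u - T^j u), so errors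
  -- add up.
  have hall : ∀ j : ℕ, ∀ᵐ x ∂(torusMeasure n),
      |(u - (fun v => μ • resolvent hμ v)^[j] u : L2 n) x| ≤ j * (2 * B / μ) := by
    intro j
    induction j with
    | zero =>
      simp
    | succ j ih =>
      have h1 := abs_resolvent_le hμ ih
      have h2 : u - (fun v => μ • resolvent hμ v)^[j + 1] u = (u - μ • resolvent hμ u)
          + μ • resolvent hμ (u - (fun v => μ • resolvent hμ v)^[j] u) := by
        rw [Function.iterate_succ_apply', map_sub, smul_sub]
        abel
      rw [h2]
      filter_upwards [hstep, h1, Lp.coeFn_add (u - μ • resolvent hμ u)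
        (μ • resolvent hμ (u - (fun v => μ • resolvent hμ v)^[j] u)),
        Lp.coeFn_smul μ (resolvent hμ (u - (fun v => μ • resolvent hμ v)^[j] u))]
        with x h3 h4 h5 h6
      rw [h5, Pi.add_apply, h6, Pi.smul_apply, smul_eq_mul]
      have h7 : |μ * resolvent hμ (u - (fun v => μ • resolvent hμ v)^[j] u) x|
          ≤ j * (2 * B / μ) := by
        rw [abs_mul, abs_of_pos hμ, mul_comm]
        exact (le_div_iff₀ hμ).mp h4
      refine ((abs_add_le _ _).trans (add_le_add h3 h7)).trans (le_of_eq ?_)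
      push_cast
      ring
  refine ⟨(fun v => μ • resolvent hμ v)^[n] u, ?_, ?_⟩
  · rw [hiter]
    exact Submodule.smul_mem _ _ (resolvent_iterate_mem_continuousL2 hμ u)
  · filter_upwards [hall n, Lp.coeFn_sub u ((fun v => μ • resolvent hμ v)^[n] u)] with x h1 h2
    rw [h2, Pi.sub_apply] at h1
    refine h1.trans ?_
    rw [← mul_div_assoc, div_le_iff₀ hμ, hμdef, mul_add, mul_div_cancel₀ _ hε.ne']
    linarith

/-- An `L²` solution of `(-Δ)^{1/2} u = h` with bounded `h` has a continuous representative. -/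
theorem mem_continuousL2_of_eq_resolvent {l : ℝ} (hl : 0 < l) {u h : L2 n} {B : ℝ}
    (hh : ∀ᵐ x ∂(torusMeasure n), |h x| ≤ B) (hu : u = resolvent hl (l • u + h)) :
    u ∈ continuousL2 n := by
  -- As u is only known to be in L², l u cannot be treated as bounded. Substituting the equation
  -- into itself leaves a rougher term with one more resolvent each time; n of them make it
  -- continuous.
  have key : ∀ j : ℕ, ∃ w ∈ continuousL2 n, u = l ^ j • (resolvent hl)^[j] u + w := by
    intro j
    induction j with
    | zero => exact ⟨0, Submodule.zero_mem _, by simp⟩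
    | succ j ih =>
      obtain ⟨w, hw, hwu⟩ := ih
      obtain ⟨C, hC⟩ := exists_bound_of_mem_continuousL2 hw
      refine ⟨l • resolvent hl w + resolvent hl h, Submodule.add_mem _ (Submodule.smul_mem _ _
        (resolvent_mem_continuousL2 hl hC)) (resolvent_mem_continuousL2 hl hh), ?_⟩
      have h1 : resolvent hl u = l ^ j • (resolvent hl)^[j + 1] u + resolvent hl w := by
        conv_lhs => rw [hwu]
        rw [map_add, map_smul, Function.iterate_succ_apply']
      conv_lhs => rw [hu]
      rw [map_add, map_smul, h1, smul_add, smul_smul, pow_succ']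
      abel
  obtain ⟨w, hw, hwu⟩ := key n
  rw [hwu]
  exact Submodule.add_mem _ (Submodule.smul_mem _ _ (resolvent_iterate_mem_continuousL2 hl u)) hw

/-! ### The superposition operator -/

/-- Continuity, the Lipschitz constant `L` in the second variable, the bound `M` and the
periodicity of an interaction force. -/
structure IsBoundedForce (φ : Torus n → ℝ → ℝ) (L M : ℝ) : Prop where
  pos : 0 < L
  continuous : Continuous (Function.uncurry φ)
  lipschitz : ∀ x y y', |φ x y - φ x y'| ≤ L * |y - y'|
  bound : ∀ x y, |φ x y| ≤ M
  periodic : ∀ x, Function.Periodic (φ x) 1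

theorem IsInteractionForce.exists_isBoundedForce {φ : Torus n → ℝ → ℝ}
    (hφ : IsInteractionForce φ) : ∃ L M, IsBoundedForce φ L M := by
  obtain ⟨K, hK⟩ := hφ.lipschitz
  have hper : ∀ x, Function.Periodic (φ x) 1 := fun x y => hφ.periodic x y
  obtain ⟨M, hM⟩ := ((isCompact_univ (X := Torus n)).prod (isCompact_Icc (a := (0 : ℝ)) (b := 1))
    |>.exists_bound_of_continuousOn hK.continuous.continuousOn)
  -- The constant K may be 0, while the resolvent needs a positive shift.
  refine ⟨K + 1, M, by positivity, hK.continuous, fun x y y' => ?_, fun x y => ?_, hper⟩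
  · have h := hK.dist_le_mul (x, y) (x, y')
    rw [Prod.dist_eq, dist_self, max_eq_right dist_nonneg, Real.dist_eq, Real.dist_eq] at h
    refine h.trans (mul_le_mul_of_nonneg_right (by simp) (abs_nonneg _))
  · have h1 : φ x y = φ x (Int.fract y) := by
      rw [← Int.self_sub_floor]
      simpa using ((hper x).sub_int_mul_eq (x := y) ⌊y⌋).symm
    rw [h1]
    exact hM (x, Int.fract y) ⟨Set.mem_univ _, Int.fract_nonneg y, (Int.fract_lt_one y).le⟩

variable {φ : Torus n → ℝ → ℝ} {L M : ℝ}

namespace IsBoundedForce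

theorem memLp (hφ : IsBoundedForce φ L M) {u : Torus n → ℝ}
    (hu : AEStronglyMeasurable u (torusMeasure n)) :
    MemLp (fun x => φ x (u x)) 2 (torusMeasure n) :=
  MemLp.of_bound (hφ.continuous.comp_aestronglyMeasurable (aestronglyMeasurable_id.prodMk hu)) M
    (.of_forall fun x => hφ.bound x _)

/-- The superposition operator `u ↦ φ(x, u(x))` on `L²(Tⁿ)`. -/
def superpose (hφ : IsBoundedForce φ L M) (u : L2 n) : L2 n :=
  (hφ.memLp (Lp.aestronglyMeasurable u)).toLp

theorem coeFn_superpose (hφ : IsBoundedForce φ L M) (u : L2 n) :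
    hφ.superpose u =ᵐ[torusMeasure n] fun x => φ x (u x) := MemLp.coeFn_toLp _

theorem abs_superpose_le (hφ : IsBoundedForce φ L M) (u : L2 n) :
    ∀ᵐ x ∂(torusMeasure n), |hφ.superpose u x| ≤ M :=
  (hφ.coeFn_superpose u).mono fun x hx => hx ▸ hφ.bound x _

theorem bound_nonneg (hφ : IsBoundedForce φ L M) : 0 ≤ M :=
  (abs_nonneg _).trans (hφ.bound 0 0)

theorem norm_superpose_le (hφ : IsBoundedForce φ L M) (u : L2 n) : ‖hφ.superpose u‖ ≤ M := by
  have := Lp.norm_le_of_ae_bound (f := hφ.superpose u) hφ.bound_nonneg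
    ((hφ.abs_superpose_le u).mono fun x hx => hx)
  have h1 : measureUnivNNReal (torusMeasure n) = 1 := by simp [measureUnivNNReal]
  simpa [h1] using this

theorem norm_superpose_sub_le (hφ : IsBoundedForce φ L M) (u v : L2 n) :
    ‖hφ.superpose u - hφ.superpose v‖ ≤ L * ‖u - v‖ := by
  apply Lp.norm_le_mul_norm_of_ae_le_mul
  filter_upwards [Lp.coeFn_sub (hφ.superpose u) (hφ.superpose v), Lp.coeFn_sub u v,
    hφ.coeFn_superpose u, hφ.coeFn_superpose v] with x h1 h2 h3 h4
  rw [h1, h2, Pi.sub_apply, Pi.sub_apply, h3, h4]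
  exact hφ.lipschitz x _ _

theorem continuous_superpose (hφ : IsBoundedForce φ L M) : Continuous hφ.superpose :=
  (LipschitzWith.of_dist_le_mul (K := L.toNNReal) fun u v => by
    rw [dist_eq_norm, dist_eq_norm, Real.coe_toNNReal _ hφ.pos.le]
    exact hφ.norm_superpose_sub_le u v).continuous

theorem superpose_add_int (hφ : IsBoundedForce φ L M) (u : L2 n) (k : ℤ) :
    hφ.superpose (u + constL2 n k) = hφ.superpose u := by
  apply Lp.ext
  filter_upwards [hφ.coeFn_superpose u, hφ.coeFn_superpose (u + constL2 n k),
    Lp.coeFn_add u (constL2 n k), coeFn_constL2 (n := n) k] with x h1 h2 h3 h4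
  rw [h1, h2, h3, Pi.add_apply, h4]
  simpa using (hφ.periodic x).int_mul k (u x)

/-- The slope of φ in y is at least -L, so the shift by L restores monotonicity. -/
theorem smul_add_superpose_mono (hφ : IsBoundedForce φ L M) {u v : L2 n} (h : u ≤ v) :
    L • u + hφ.superpose u ≤ L • v + hφ.superpose v := by
  rw [← Lp.coeFn_le] at h ⊢
  filter_upwards [h, Lp.coeFn_add (L • u) (hφ.superpose u), Lp.coeFn_add (L • v) (hφ.superpose v),
    hφ.coeFn_superpose u, hφ.coeFn_superpose v, Lp.coeFn_smul L u, Lp.coeFn_smul L v]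
    with x h1 h2 h3 h4 h5 h6 h7
  rw [h2, h3, Pi.add_apply, Pi.add_apply, h4, h5, h6, h7, Pi.smul_apply, Pi.smul_apply, smul_eq_mul,
    smul_eq_mul]
  have := hφ.lipschitz x (u x) (v x)
  rw [abs_sub_comm (u x), abs_of_nonneg (sub_nonneg.mpr h1)] at this
  linarith [(abs_le.mp this).2]

/-! ### The fixed point map -/

/-- The map `u ↦ (L + (-Δ)^{1/2})⁻¹ (L u + φ(x, u) + F)`, whose fixed points are the solutions. -/
def step (hφ : IsBoundedForce φ L M) (F : ℝ) (u : L2 n) : L2 n :=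
  resolvent hφ.pos (L • u + (hφ.superpose u + constL2 n F))

theorem step_eq_add (hφ : IsBoundedForce φ L M) (F G : ℝ) (u : L2 n) :
    hφ.step F u = hφ.step G u + constL2 n ((F - G) / L) := by
  rw [← resolvent_const hφ.pos, step, step, ← map_add, constL2_sub]
  congr 1
  abel

theorem continuous_step (hφ : IsBoundedForce φ L M) (F : ℝ) : Continuous (hφ.step F) := by
  have := hφ.continuous_superpose
  unfold step
  fun_prop

theorem step_mono (hφ : IsBoundedForce φ L M) (F : ℝ) : Monotone (hφ.step F) := by
  intro u v h
  rw [step, step, ← add_assoc, ← add_assoc]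
  exact resolvent_mono _ (add_le_add_left (hφ.smul_add_superpose_mono h) _)

theorem step_add_int (hφ : IsBoundedForce φ L M) (F : ℝ) (u : L2 n) (k : ℤ) :
    hφ.step F (u + constL2 n k) = hφ.step F u + constL2 n k := by
  have h : L • constL2 n ((k : ℝ) / L) = constL2 n k := by
    apply Lp.ext
    filter_upwards [Lp.coeFn_smul L (constL2 n ((k : ℝ) / L)), coeFn_constL2 (n := n) ((k : ℝ) / L),
      coeFn_constL2 (n := n) (k : ℝ)] with x h1 h2 h3
    rw [h1, h3, Pi.smul_apply, h2, smul_eq_mul, mul_div_cancel₀ _ hφ.pos.ne']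
  rw [step, step, superpose_add_int, smul_add, add_right_comm, map_add, map_smul _ L (constL2 n k),
    resolvent_const, h]

theorem step_eq_iff (hφ : IsBoundedForce φ L M) (F : ℝ) (u : L2 n) :
    hφ.step F u = u ↔ ∀ k, (halfSymbol k : ℂ) * fourierHat u k
      = fourierHat (hφ.superpose u + constL2 n F : L2 n) k := by
  rw [eq_comm, step, eq_resolvent_iff]
  refine forall_congr' fun k => ?_
  rw [fourierHat_add, fourierHat_smul, Complex.ofReal_add, add_mul, add_right_inj]

theorem mem_continuousL2_of_step_eq (hφ : IsBoundedForce φ L M) {F : ℝ} {u : L2 n}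
    (hu : hφ.step F u = u) : u ∈ continuousL2 n := by
  refine mem_continuousL2_of_eq_resolvent hφ.pos (B := M + |F|)
    (h := hφ.superpose u + constL2 n F) ?_ hu.symm
  filter_upwards [Lp.coeFn_add (hφ.superpose u) (constL2 n F), coeFn_constL2 (n := n) F,
    hφ.abs_superpose_le u] with x h1 h2 h3
  rw [h1, Pi.add_apply, h2]
  exact (abs_add_le _ _).trans (add_le_add_left h3 _)

/-- Limits of bounded sequences of approximate fixed points. -/
theorem exists_step_eq_of_tendsto (hφ : IsBoundedForce φ L M) {F : ℝ} {G : ℕ → ℝ}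
    (hG : Filter.Tendsto G Filter.atTop (nhds F)) {u : ℕ → L2 n} {C : ℝ} (hC : ∀ j, ‖u j‖ ≤ C)
    (hu : Filter.Tendsto (fun j => hφ.step (G j) (u j) - u j) Filter.atTop (nhds 0)) :
    ∃ v, hφ.step F v = v := by
  have h0 : Filter.Tendsto (fun j => constL2 n ((F - G j) / L)) Filter.atTop (nhds 0) := by
    rw [tendsto_zero_iff_norm_tendsto_zero]
    simp only [norm_constL2]
    have : Filter.Tendsto (fun j => |(F - G j) / L|) Filter.atTop (nhds |(F - F) / L|) :=
      ((hG.const_sub F).div_const L).abs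
    simpa using this
  have h1 : Filter.Tendsto (fun j => hφ.step F (u j) - u j) Filter.atTop (nhds 0) := by
    have := hu.add h0
    rw [add_zero] at this
    refine this.congr fun j => ?_
    rw [hφ.step_eq_add F (G j)]
    abel
  -- The images T_F u_j lie in one compact set. As T_F u_j - u_j → 0, the u_j converge along the
  -- same subsequence, to the same limit.
  obtain ⟨K, hK, hKsub⟩ := (isCompactOperator_resolvent (n := n) hφ.pos).image_closedBall_subset_compact
    (f := (resolvent (n := n) hφ.pos).toLinearMap) (L * C + (M + |F|))
  have hmem : ∀ j, hφ.step F (u j) ∈ K := by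
    intro j
    refine hKsub ⟨_, ?_, rfl⟩
    rw [mem_closedBall_zero_iff]
    refine (norm_add_le _ _).trans (add_le_add ?_ ((norm_add_le _ _).trans (add_le_add
      (hφ.norm_superpose_le _) (norm_constL2 F).le)))
    rw [norm_smul, Real.norm_of_nonneg hφ.pos.le]
    exact mul_le_mul_of_nonneg_left (hC j) hφ.pos.le
  obtain ⟨v, -, ψ, hψ, hv⟩ := hK.tendsto_subseq hmem
  have h2 : Filter.Tendsto (fun j => u (ψ j)) Filter.atTop (nhds v) := by
    have := hv.sub (h1.comp hψ.tendsto_atTop)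
    rw [sub_zero] at this
    refine this.congr fun j => ?_
    simp
  exact ⟨v, tendsto_nhds_unique (((hφ.continuous_step F).tendsto v).comp h2) hv⟩

/-! ### Ordered sub- and supersolutions -/

theorem _root_.StickSlip.inner_nonneg_of_nonneg {f g : L2 n} (hf : 0 ≤ f) (hg : 0 ≤ g) :
    0 ≤ inner ℝ f g := by
  rw [L2.inner_def]
  refine integral_nonneg_of_ae ?_
  filter_upwards [(Lp.coeFn_nonneg f).mpr hf, (Lp.coeFn_nonneg g).mpr hg] with x h1 h2
  simp only [RCLike.inner_apply, conj_trivial]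
  exact mul_nonneg h2 h1

theorem _root_.StickSlip.norm_le_norm_of_nonneg_of_le {f g : L2 n} (hf : 0 ≤ f) (h : f ≤ g) :
    ‖f‖ ≤ ‖g‖ := by
  apply norm_le_norm_of_abs_le_abs
  rwa [abs_of_nonneg hf, abs_of_nonneg (hf.trans h)]

/-- The iterates of a increase and stay below b. Consecutive increments have nonnegative inner
products with u_j - a, so ‖u_j - a‖² grows by at least the squared increment. Being bounded, it
converges, and the iterates become approximate fixed points. -/
theorem exists_step_eq_of_le (hφ : IsBoundedForce φ L M) {F : ℝ} {a b : L2 n} (hab : a ≤ b)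
    (ha : a ≤ hφ.step F a) (hb : hφ.step F b ≤ b) : ∃ v, hφ.step F v = v := by
  set u : ℕ → L2 n := fun j => (hφ.step F)^[j] a with hu
  have hsucc : ∀ j, hφ.step F (u j) = u (j + 1) := fun j =>
    (Function.iterate_succ_apply' _ _ _).symm
  have hmono : Monotone u := (hφ.step_mono F).monotone_iterate_of_le_map ha
  have hle : ∀ j, u j ≤ b := by
    intro j
    induction j with
    | zero => exact hab
    | succ j ih => exact hsucc j ▸ ((hφ.step_mono F) ih).trans hb
  have hge : ∀ j, a ≤ u j := fun j => hmono (Nat.zero_le j)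
  have hbd : ∀ j, ‖u j - a‖ ≤ ‖b - a‖ := fun j =>
    norm_le_norm_of_nonneg_of_le (sub_nonneg.mpr (hge j)) (sub_le_sub_right (hle j) a)
  have hinc : ∀ j, ‖u (j + 1) - u j‖ ^ 2 ≤ ‖u (j + 1) - a‖ ^ 2 - ‖u j - a‖ ^ 2 := by
    intro j
    have h1 : u (j + 1) - a = (u j - a) + (u (j + 1) - u j) := by abel
    rw [h1, norm_add_sq_real]
    have := inner_nonneg_of_nonneg (sub_nonneg.mpr (hge j)) (sub_nonneg.mpr (hmono j.le_succ))
    linarith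
  have hsmono : Monotone fun j => ‖u j - a‖ ^ 2 :=
    monotone_nat_of_le_succ fun j => by nlinarith [hinc j, sq_nonneg ‖u (j + 1) - u j‖]
  have hbdd : BddAbove (Set.range fun j => ‖u j - a‖ ^ 2) := by
    refine ⟨‖b - a‖ ^ 2, ?_⟩
    rintro _ ⟨j, rfl⟩
    exact pow_le_pow_left₀ (norm_nonneg _) (hbd j) 2
  have hlim := tendsto_atTop_ciSup hsmono hbdd
  have hdiff : Filter.Tendsto (fun j => ‖u (j + 1) - u j‖ ^ 2) Filter.atTop (nhds 0) := by
    have h2 := ((Filter.tendsto_add_atTop_iff_nat 1).mpr hlim).sub hlim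
    rw [sub_self] at h2
    exact squeeze_zero (fun j => by positivity) hinc h2
  refine hφ.exists_step_eq_of_tendsto (G := fun _ => F) tendsto_const_nhds (u := u)
    (C := ‖b - a‖ + ‖a‖) (fun j => ?_) ?_
  · have h3 := norm_le_norm_sub_add (u j) a
    linarith [hbd j]
  · rw [tendsto_zero_iff_norm_tendsto_zero]
    have h4 := hdiff.sqrt
    simpa only [hsucc, Real.sqrt_sq (norm_nonneg _), Real.sqrt_zero] using h4

/-- Solutions at `F₀ ≤ F ≤ F₁` produce a solution at `F`. -/
theorem exists_step_eq_of_between (hφ : IsBoundedForce φ L M) {F₀ F F₁ : ℝ} (h0 : F₀ ≤ F)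
    (h1 : F ≤ F₁) {a b : L2 n} (ha : hφ.step F₀ a = a) (hb : hφ.step F₁ b = b) :
    ∃ v, hφ.step F v = v := by
  have hconst : ∀ c : ℝ, 0 ≤ c → 0 ≤ constL2 n c := by
    intro c hc
    rw [← Lp.coeFn_nonneg]
    filter_upwards [coeFn_constL2 (n := n) c] with x hx
    rw [hx]; exact hc
  obtain ⟨A, hA⟩ := exists_bound_of_mem_continuousL2 (hφ.mem_continuousL2_of_step_eq ha)
  obtain ⟨B, hB⟩ := exists_bound_of_mem_continuousL2 (hφ.mem_continuousL2_of_step_eq hb)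
  -- Then a + k ≤ -B ≤ b almost everywhere.
  set k : ℤ := -⌈A + B⌉ with hk
  have hL := hφ.pos
  refine hφ.exists_step_eq_of_le (a := a + constL2 n k) (b := b) ?_ ?_ ?_
  · rw [← Lp.coeFn_le]
    filter_upwards [hA, hB, Lp.coeFn_add a (constL2 n k), coeFn_constL2 (n := n) k]
      with x h2 h3 h4 h5
    rw [h4, Pi.add_apply, h5, hk]
    have := Int.le_ceil (A + B)
    push_cast
    linarith [(abs_le.mp h2).2, (abs_le.mp h3).1]
  · rw [step_add_int, hφ.step_eq_add F F₀, ha]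
    exact add_le_add_left (le_add_of_nonneg_right
      (hconst _ (div_nonneg (sub_nonneg.mpr h0) hL.le))) _
  · have h2 := hφ.step_eq_add F₁ F b
    rw [hb] at h2
    conv_rhs => rw [h2]
    exact le_add_of_nonneg_right (hconst _ (div_nonneg (sub_nonneg.mpr h1) hL.le))

/-! ### Normalization and a priori bounds -/

/-- The mean is real; subtracting its floor leaves its fractional part. -/
theorem _root_.StickSlip.exists_int_norm_fourierHat_zero_le (u : L2 n) :
    ∃ k : ℤ, ‖fourierHat (u + constL2 n k : L2 n) 0‖ ≤ 1 := by
  have h1 : (starRingEnd ℂ) (fourierHat u 0) = fourierHat u 0 := by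
    rw [← fourierHat_neg, neg_zero]
  obtain ⟨r, hr⟩ := Complex.conj_eq_iff_real.mp h1
  refine ⟨-⌊r⌋, ?_⟩
  rw [fourierHat_add, fourierHat_const, if_pos rfl, hr, ← Complex.ofReal_add, Complex.norm_real]
  push_cast
  rw [← sub_eq_add_neg, Int.self_sub_floor, Real.norm_of_nonneg (Int.fract_nonneg r)]
  exact (Int.fract_lt_one r).le

/-- The symbol is at least 1 off k = 0, so the right-hand side of the equation controls every mode
except the mean. -/
theorem norm_sq_le_of_step_eq (hφ : IsBoundedForce φ L M) {F : ℝ} {u : L2 n}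
    (hu : hφ.step F u = u) (h0 : ‖fourierHat u 0‖ ≤ 1) : ‖u‖ ^ 2 ≤ 1 + (M + |F|) ^ 2 := by
  rw [step_eq_iff] at hu
  set h := hφ.superpose u + constL2 n F with hh
  have hn : ‖h‖ ≤ M + |F| := (norm_add_le _ _).trans (add_le_add
      (hφ.norm_superpose_le _) (norm_constL2 F).le)
  have h1 : ∀ k, ‖fourierHat u k‖ ^ 2 ≤ (if k = 0 then (1 : ℝ) else 0) + ‖fourierHat h k‖ ^ 2 := by
    intro k
    rcases eq_or_ne k 0 with rfl | hk
    · rw [if_pos rfl]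
      nlinarith [norm_nonneg (fourierHat u 0), sq_nonneg ‖fourierHat h 0‖]
    · rw [if_neg hk, zero_add, ← hu k, norm_mul, Complex.norm_real,
        Real.norm_of_nonneg (halfSymbol_nonneg k)]
      exact pow_le_pow_left₀ (norm_nonneg _)
        (le_mul_of_one_le_left (norm_nonneg _) (one_le_halfSymbol hk)) 2
  have h2 := hasSum_le h1 (hasSum_norm_sq u) ((hasSum_ite_eq 0 1).add (hasSum_norm_sq h))
  nlinarith [norm_nonneg h]

/-- At k = 0 the symbol vanishes, so F is minus the mean of φ(x, u(x)). -/
theorem le_bound_of_step_eq (hφ : IsBoundedForce φ L M) {F : ℝ} {u : L2 n}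
    (hu : hφ.step F u = u) : F ≤ M := by
  have h := (hφ.step_eq_iff F u).mp hu 0
  rw [halfSymbol_zero, Complex.ofReal_zero, zero_mul, fourierHat_add, fourierHat_const,
    if_pos rfl] at h
  have h1 : (F : ℂ) = -fourierHat (hφ.superpose u) 0 := by linear_combination -h
  have h2 := (norm_fourierHat_le (hφ.superpose u) 0).trans (hφ.norm_superpose_le u)
  rw [← norm_neg, ← h1, Complex.norm_real] at h2
  exact (le_abs_self F).trans h2

/-- The set of forces with a solution is closed. -/
theorem exists_step_eq_of_tendsto_force (hφ : IsBoundedForce φ L M) {F : ℝ} {G : ℕ → ℝ}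
    (hG : Filter.Tendsto G Filter.atTop (nhds F)) (h : ∀ j, ∃ u, hφ.step (G j) u = u) :
    ∃ v, hφ.step F v = v := by
  choose u hu using h
  choose k hk using fun j => exists_int_norm_fourierHat_zero_le (u j)
  have hfix : ∀ j, hφ.step (G j) (u j + constL2 n (k j)) = u j + constL2 n (k j) := fun j => by
    rw [step_add_int, hu]
  obtain ⟨C, hC⟩ := hG.abs.bddAbove_range
  refine hφ.exists_step_eq_of_tendsto hG (u := fun j => u j + constL2 n (k j))
    (C := Real.sqrt (1 + (M + C) ^ 2)) (fun j => ?_) ?_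
  · refine Real.le_sqrt_of_sq_le ((hφ.norm_sq_le_of_step_eq (hfix j) (hk j)).trans ?_)
    have h1 : |G j| ≤ C := hC ⟨j, rfl⟩
    have := hφ.bound_nonneg
    gcongr
  · simp only [hfix, sub_self]
    exact tendsto_const_nhds

end IsBoundedForce

/-! ### The potential -/

/-- The potential `Φ(x, y) = ∫₀^y φ(x, s) ds`. -/
def potential (φ : Torus n → ℝ → ℝ) (x : Torus n) (y : ℝ) : ℝ := ∫ s in (0 : ℝ)..y, φ x s

namespace IsBoundedForce

theorem continuous_apply (hφ : IsBoundedForce φ L M) (x : Torus n) : Continuous (φ x) :=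
  hφ.continuous.comp (by fun_prop : Continuous fun y : ℝ => (x, y))

theorem continuous_potential (hφ : IsBoundedForce φ L M) :
    Continuous (Function.uncurry (potential φ)) :=
  intervalIntegral.continuous_parametric_primitive_of_continuous hφ.continuous

theorem abs_potential_le (hφ : IsBoundedForce φ L M) (x : Torus n) (y : ℝ) :
    |potential φ x y| ≤ M * |y| := by
  have := intervalIntegral.norm_integral_le_of_norm_le_const (a := 0) (b := y) (f := φ x) (C := M)
    fun s _ => hφ.bound x s
  rwa [sub_zero] at this

theorem hasDerivAt_potential (hφ : IsBoundedForce φ L M) (x : Torus n) (y : ℝ) :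
    HasDerivAt (potential φ x) (φ x y) y :=
  (hφ.continuous_apply x).integral_hasStrictDerivAt 0 y |>.hasDerivAt

/-- The tangent line inequality for the semiconvex potential. -/
theorem potential_sub_ge (hφ : IsBoundedForce φ L M) (x : Torus n) (y z : ℝ) :
    φ x y * (z - y) - L / 2 * (z - y) ^ 2 ≤ potential φ x z - potential φ x y := by
  -- The derivative φ(x,s) + L(s - y) is at least φ(x,y) for s > y and at most φ(x,y) for s < y, so
  -- the mean value theorem gives the inequality on both sides.
  have hder : ∀ s, HasDerivAt (fun s => potential φ x s + L / 2 * (s - y) ^ 2)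
      (φ x s + L * (s - y)) s := by
    intro s
    have h1 := (((hasDerivAt_id s).sub_const y).pow 2).const_mul (L / 2)
    refine ((hφ.hasDerivAt_potential x s).add h1).congr_deriv ?_
    simp
    ring
  have hcont : Continuous fun s => potential φ x s + L / 2 * (s - y) ^ 2 :=
    continuous_iff_continuousAt.mpr fun s => (hder s).continuousAt
  rcases lt_trichotomy y z with h | h | h
  · obtain ⟨c, hc, hce⟩ := exists_hasDerivAt_eq_slope _ _ h hcont.continuousOn fun s _ => hder s
    rw [eq_div_iff (by linarith)] at hce
    have h2 := (abs_le.mp (hφ.lipschitz x c y)).1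
    rw [abs_of_pos (by linarith [hc.1])] at h2
    nlinarith [hc.1]
  · rw [h]; simp
  · obtain ⟨c, hc, hce⟩ := exists_hasDerivAt_eq_slope _ _ h hcont.continuousOn fun s _ => hder s
    rw [eq_div_iff (by linarith)] at hce
    have h2 := (abs_le.mp (hφ.lipschitz x c y)).2
    rw [abs_of_neg (by linarith [hc.2])] at h2
    nlinarith [hc.2]

theorem potential_add_int (hφ : IsBoundedForce φ L M) (x : Torus n) (y : ℝ) (k : ℤ) :
    potential φ x (y + k) = potential φ x y + k * ∫ s in (0 : ℝ)..1, φ x s := by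
  have hint : ∀ a b, IntervalIntegrable (φ x) volume a b := fun a b =>
    (hφ.continuous_apply x).intervalIntegrable a b
  have h1 := (hφ.periodic x).intervalIntegral_add_zsmul_eq k y hint
  have h2 := (hφ.periodic x).intervalIntegral_add_eq y 0
  rw [zero_add] at h2
  rw [h2] at h1
  simp only [zsmul_eq_mul, mul_one] at h1
  rw [potential, potential, ← h1, intervalIntegral.integral_add_adjacent_intervals (hint _ _)
    (hint _ _)]

theorem integrable_potential (hφ : IsBoundedForce φ L M) (u : L2 n) :
    Integrable (fun x => potential φ x (u x)) (torusMeasure n) := by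
  have hu : Integrable u (torusMeasure n) := (Lp.memLp u).integrable (by norm_num)
  refine (hu.norm.const_mul M).mono' (hφ.continuous_potential.comp_aestronglyMeasurable
    (aestronglyMeasurable_id.prodMk (Lp.aestronglyMeasurable u)))
    (.of_forall fun x => hφ.abs_potential_le x _)

theorem _root_.StickSlip.integral_abs_le_norm (u : L2 n) :
    ∫ x, |u x| ∂(torusMeasure n) ≤ ‖u‖ := by
  have h1 : ∫ x, |u x| ∂(torusMeasure n) = inner ℝ |u| (constL2 n 1) := by
    rw [L2.inner_def]
    refine integral_congr_ae ?_
    filter_upwards [Lp.coeFn_abs u, coeFn_constL2 (n := n) 1] with x h1 h2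
    simp [h1, h2]
  rw [h1]
  refine (real_inner_le_norm _ _).trans ?_
  rw [norm_abs_eq, norm_constL2, abs_one, mul_one]

theorem abs_integral_potential_le (hφ : IsBoundedForce φ L M) (u : L2 n) :
    |∫ x, potential φ x (u x) ∂(torusMeasure n)| ≤ M * ‖u‖ := by
  have hu : Integrable u (torusMeasure n) := (Lp.memLp u).integrable (by norm_num)
  refine (norm_integral_le_of_norm_le (f := fun x => potential φ x (u x)) (hu.norm.const_mul M)
    (.of_forall fun x => hφ.abs_potential_le x _)).trans ?_
  rw [integral_const_mul]
  exact mul_le_mul_of_nonneg_left (integral_abs_le_norm u) hφ.bound_nonneg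

/-- The average of the force over one period vanishes after integration over the torus. -/
theorem integral_average_eq_zero (hφ : IsBoundedForce φ L M) (h : IsInteractionForce φ) :
    ∫ x, (∫ s in (0 : ℝ)..1, φ x s) ∂(torusMeasure n) = 0 := by
  have h0 := h.average_zero
  rw [setIntegral_prod] at h0
  · rw [Measure.restrict_univ] at h0
    refine Eq.trans (integral_congr_ae (.of_forall fun x => ?_)) h0
    beta_reduce
    rw [intervalIntegral.integral_of_le zero_le_one, integral_Ico_eq_integral_Ioc]
  · refine Measure.integrableOn_of_bounded (M := M) ?_
      hφ.continuous.aestronglyMeasurable (.of_forall fun p => hφ.bound p.1 p.2)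
    rw [Measure.prod_prod]
    simp

/-- A shift by k adds k times the one-period integral of φ(x,·), whose integral over the torus is
zero. Here the vanishing average enters. -/
theorem integral_potential_add_int (hφ : IsBoundedForce φ L M) (h : IsInteractionForce φ)
    (u : L2 n) (k : ℤ) :
    ∫ x, potential φ x ((u + constL2 n k : L2 n) x) ∂(torusMeasure n)
      = ∫ x, potential φ x (u x) ∂(torusMeasure n) := by
  have h1 : (fun x => potential φ x ((u + constL2 n k : L2 n) x)) =ᵐ[torusMeasure n]
      fun x => potential φ x (u x) + k * ∫ s in (0 : ℝ)..1, φ x s := by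
    filter_upwards [Lp.coeFn_add u (constL2 n k), coeFn_constL2 (n := n) k] with x h2 h3
    rw [h2, Pi.add_apply, h3, hφ.potential_add_int]
  have h2 : Integrable (fun x => (k : ℝ) * ∫ s in (0 : ℝ)..1, φ x s) (torusMeasure n) := by
    refine Integrable.const_mul (Integrable.of_bound ?_ M (.of_forall fun x => ?_)) _
    · exact (hφ.continuous_potential.comp (by fun_prop : Continuous fun x : Torus n =>
        (x, (1 : ℝ)))).aestronglyMeasurable
    · simpa [potential] using hφ.abs_potential_le x 1
  rw [integral_congr_ae h1, integral_add (hφ.integrable_potential u) h2, integral_const_mul,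
    hφ.integral_average_eq_zero h, mul_zero, add_zero]

/-! ### The energy -/

/-- Membership of a class in `H^{1/2}`. -/
def _root_.StickSlip.FiniteEnergy (u : L2 n) : Prop :=
  Summable fun k => halfSymbol k * ‖fourierHat u k‖ ^ 2

theorem _root_.StickSlip.halfSymbol_mul_add_const (u : L2 n) (c : ℝ) (k : Fin n → ℤ) :
    halfSymbol k * ‖fourierHat (u + constL2 n c : L2 n) k‖ ^ 2
      = halfSymbol k * ‖fourierHat u k‖ ^ 2 := by
  rw [fourierHat_add, fourierHat_const]
  split_ifs with h
  · rw [h, halfSymbol_zero, zero_mul, zero_mul]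
  · rw [add_zero]

/-- The energy whose critical points are the solutions without external force. -/
def _root_.StickSlip.energy (φ : Torus n → ℝ → ℝ) (u : L2 n) : ℝ :=
  (∑' k, halfSymbol k * ‖fourierHat u k‖ ^ 2) / 2 - ∫ x, potential φ x (u x) ∂(torusMeasure n)

theorem _root_.StickSlip.FiniteEnergy.add_const {u : L2 n} (hu : FiniteEnergy u) (c : ℝ) :
    FiniteEnergy (u + constL2 n c) := by
  simpa only [FiniteEnergy, halfSymbol_mul_add_const] using hu

theorem energy_add_int (hφ : IsBoundedForce φ L M) (h : IsInteractionForce φ) (u : L2 n) (k : ℤ) :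
    energy φ (u + constL2 n k) = energy φ u := by
  simp only [energy, halfSymbol_mul_add_const, hφ.integral_potential_add_int h]

theorem finiteEnergy_step (hφ : IsBoundedForce φ L M) (F : ℝ) (u : L2 n) :
    FiniteEnergy (hφ.step F u) := summable_halfSymbol_resolvent _ _

theorem inner_superpose_le (hφ : IsBoundedForce φ L M) (u v : L2 n) :
    inner ℝ (hφ.superpose u) (v - u) - L / 2 * ‖v - u‖ ^ 2
      ≤ ∫ x, potential φ x (v x) ∂(torusMeasure n)
        - ∫ x, potential φ x (u x) ∂(torusMeasure n) := by
  rw [← real_inner_self_eq_norm_sq, L2.inner_def, L2.inner_def, ← integral_const_mul,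
    ← integral_sub (L2.integrable_inner _ _) ((L2.integrable_inner _ _).const_mul _),
    ← integral_sub (hφ.integrable_potential v) (hφ.integrable_potential u)]
  refine integral_mono_ae ((L2.integrable_inner _ _).sub ((L2.integrable_inner _ _).const_mul _))
    ((hφ.integrable_potential v).sub (hφ.integrable_potential u)) ?_
  filter_upwards [hφ.coeFn_superpose u, Lp.coeFn_sub v u] with x h1 h2
  simp only [RCLike.inner_apply, conj_trivial, h1, h2, Pi.sub_apply]
  have := hφ.potential_sub_ge x (u x) (v x)
  nlinarith

/-- The fixed point map decreases the energy. -/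
theorem energy_step_le (hφ : IsBoundedForce φ L M) {u : L2 n} (hu : FiniteEnergy u) :
    energy φ (hφ.step 0 u) + L / 2 * ‖hφ.step 0 u - u‖ ^ 2 ≤ energy φ u := by
  set v := hφ.step 0 u with hv
  have hvs : FiniteEnergy v := hφ.finiteEnergy_step 0 u
  have hhat : ∀ k, (halfSymbol k : ℂ) * fourierHat v k
      = fourierHat (hφ.superpose u) k - L * fourierHat (v - u : L2 n) k := by
    intro k
    have h1 := (eq_resolvent_iff hφ.pos v _).mp hv k
    rw [fourierHat_add, fourierHat_add, fourierHat_const, fourierHat_smul, Complex.ofReal_zero,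
      ite_self, add_zero] at h1
    rw [fourierHat_sub]
    push_cast at h1
    linear_combination h1
  -- This is |a|² - |b|² = 2 Re(a·conj(a - b)) - |a - b|² times the symbol, with the last term
  -- dropped. It gains L‖v - u‖², of which the semiconvexity of the potential uses half.
  have key : ∀ k, halfSymbol k * ‖fourierHat v k‖ ^ 2 - halfSymbol k * ‖fourierHat u k‖ ^ 2
      ≤ 2 * (fourierHat (hφ.superpose u) k * (starRingEnd ℂ) (fourierHat (v - u : L2 n) k)).re
        - 2 * L * ‖fourierHat (v - u : L2 n) k‖ ^ 2 := by
    intro k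
    have h1 : fourierHat (hφ.superpose u) k
        = (halfSymbol k : ℂ) * fourierHat v k + L * fourierHat (v - u : L2 n) k := by
      linear_combination -hhat k
    have hs := halfSymbol_nonneg k
    rw [h1, fourierHat_sub]
    generalize fourierHat v k = a
    generalize fourierHat u k = b
    simp only [← Complex.normSq_eq_norm_sq, Complex.normSq_apply, Complex.mul_re, Complex.mul_im,
      Complex.conj_re, Complex.conj_im, Complex.ofReal_re, Complex.ofReal_im, Complex.sub_re,
      Complex.sub_im, Complex.add_re, Complex.add_im]
    nlinarith [mul_nonneg hs (sq_nonneg (a.re - b.re)), mul_nonneg hs (sq_nonneg (a.im - b.im))]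
  have h1 := hasSum_le key (hvs.hasSum.sub hu.hasSum)
    (((hasSum_inner (hφ.superpose u) (v - u)).mul_left 2).sub
      ((hasSum_norm_sq (v - u)).mul_left (2 * L)))
  have h2 := hφ.inner_superpose_le u v
  simp only [energy]
  linarith

/-- Coercivity: the spectral gap controls all modes but the mean, while the potential grows only
linearly. -/
theorem energy_ge (hφ : IsBoundedForce φ L M) {u : L2 n} (hu : FiniteEnergy u)
    (h0 : ‖fourierHat u 0‖ ≤ 1) : (‖u‖ ^ 2 - 1) / 2 - M * ‖u‖ ≤ energy φ u := by
  have h1 : ∀ k, ‖fourierHat u k‖ ^ 2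
      ≤ (if k = 0 then (1 : ℝ) else 0) + halfSymbol k * ‖fourierHat u k‖ ^ 2 := by
    intro k
    rcases eq_or_ne k 0 with rfl | hk
    · rw [if_pos rfl, halfSymbol_zero]
      nlinarith [norm_nonneg (fourierHat u 0)]
    · rw [if_neg hk, zero_add]
      exact le_mul_of_one_le_left (sq_nonneg _) (one_le_halfSymbol hk)
  have h2 := hasSum_le h1 (hasSum_norm_sq u) ((hasSum_ite_eq 0 1).add hu.hasSum)
  have h3 := (abs_le.mp (hφ.abs_integral_potential_le u)).2
  simp only [energy]
  linarith

/-- The equation without external force has a solution. -/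
theorem exists_step_zero_eq (hφ : IsBoundedForce φ L M) (h : IsInteractionForce φ) :
    ∃ v, hφ.step 0 v = v := by
  set S : Set ℝ := {E | ∃ u : L2 n, FiniteEnergy u ∧ energy φ u = E} with hS
  have hne : S.Nonempty := ⟨_, hφ.step 0 0, hφ.finiteEnergy_step 0 0, rfl⟩
  have hnorm : ∀ u : L2 n, FiniteEnergy u → ∃ v : L2 n, FiniteEnergy v ∧
      energy φ v = energy φ u ∧ ‖fourierHat v 0‖ ≤ 1 := by
    intro u hu
    obtain ⟨k, hk⟩ := exists_int_norm_fourierHat_zero_le u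
    exact ⟨_, hu.add_const k, hφ.energy_add_int h u k, hk⟩
  have hbdd : BddBelow S := by
    refine ⟨-(1 / 2) - M ^ 2 / 2, ?_⟩
    rintro _ ⟨u, hu, rfl⟩
    obtain ⟨v, hv, hvu, hv0⟩ := hnorm u hu
    rw [← hvu]
    nlinarith [hφ.energy_ge hv hv0, sq_nonneg (‖v‖ - M)]
  have hmin : ∀ j : ℕ, ∃ u : L2 n, FiniteEnergy u ∧ energy φ u < sInf S + 1 / ((j : ℝ) + 1) ∧
      ‖fourierHat u 0‖ ≤ 1 := by
    intro j
    obtain ⟨_, ⟨u, hu, rfl⟩, hlt⟩ := exists_lt_of_csInf_lt hne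
      (lt_add_of_pos_right (sInf S) (by positivity : 0 < 1 / ((j : ℝ) + 1)))
    obtain ⟨v, hv, hvu, hv0⟩ := hnorm u hu
    exact ⟨v, hv, hvu ▸ hlt, hv0⟩
  choose u hu hlt h0 using hmin
  have hL := hφ.pos
  have hone : ∀ j : ℕ, 1 / ((j : ℝ) + 1) ≤ 1 := fun j => by
    rw [div_le_one (by positivity)]
    linarith [(Nat.cast_nonneg j : (0 : ℝ) ≤ j)]
  -- The constant C comes from `energy_ge`, energy below inf + 1, and M‖u‖ ≤ ‖u‖²/4 + M².
  refine hφ.exists_step_eq_of_tendsto (G := fun _ => 0) tendsto_const_nhds (u := u)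
    (C := Real.sqrt (4 * (sInf S + 1 + 1 / 2 + M ^ 2))) (fun j => ?_) ?_
  · refine Real.le_sqrt_of_sq_le ?_
    nlinarith [hφ.energy_ge (hu j) (h0 j), hlt j, hone j, sq_nonneg (‖u j‖ - 2 * M)]
  · rw [tendsto_zero_iff_norm_tendsto_zero]
    have h1 : ∀ j, ‖hφ.step 0 (u j) - u j‖ ^ 2 ≤ 2 / L * (1 / ((j : ℝ) + 1)) := by
      intro j
      have h2 := hφ.energy_step_le (hu j)
      have h3 : sInf S ≤ energy φ (hφ.step 0 (u j)) :=
        csInf_le hbdd ⟨_, hφ.finiteEnergy_step 0 (u j), rfl⟩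
      have h4 := hlt j
      have h5 : L / 2 * ‖hφ.step 0 (u j) - u j‖ ^ 2 ≤ 1 / ((j : ℝ) + 1) := by linarith
      rw [div_mul_eq_mul_div, le_div_iff₀ hL]
      linarith
    have h2 : Filter.Tendsto (fun j : ℕ => 2 / L * (1 / ((j : ℝ) + 1))) Filter.atTop (nhds 0) := by
      simpa using tendsto_one_div_add_atTop_nhds_zero_nat.const_mul (2 / L)
    have h3 := (squeeze_zero (fun j => by positivity) h1 h2).sqrt
    simpa only [Real.sqrt_sq (norm_nonneg _), Real.sqrt_zero] using h3

end IsBoundedForce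

/-! ### Weak and classical solutions as fixed points -/

theorem integral_mul_eq_inner {f v : Torus n → ℝ} {p w : L2 n} (hp : p =ᵐ[torusMeasure n] f)
    (hw : w =ᵐ[torusMeasure n] v) : ∫ x, f x * v x ∂(torusMeasure n) = inner ℝ p w := by
  rw [L2.inner_def]
  refine integral_congr_ae ?_
  filter_upwards [hp, hw] with x h1 h2
  rw [RCLike.inner_apply, conj_trivial, h1, h2, mul_comm]

namespace IsBoundedForce

theorem coeFn_superpose_add_const (hφ : IsBoundedForce φ L M) {u : L2 n} {g : Torus n → ℝ}
    (hu : u =ᵐ[torusMeasure n] g) (F : ℝ) :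
    (hφ.superpose u + constL2 n F : L2 n) =ᵐ[torusMeasure n] fun x => φ x (g x) + F := by
  filter_upwards [hu, hφ.coeFn_superpose u, coeFn_constL2 (n := n) F,
    Lp.coeFn_add (hφ.superpose u) (constL2 n F)] with x h1 h2 h3 h4
  rw [h4, Pi.add_apply, h2, h3, h1]

/-- A fixed point has a representative that is a weak and a classical solution. -/
theorem exists_solution_of_step_eq (hφ : IsBoundedForce φ L M) {F : ℝ} {u : L2 n}
    (hu : hφ.step F u = u) : ∃ g, IsWeakSolution φ F g ∧ IsClassicalSolution φ F g := by
  obtain ⟨g, hg⟩ := mem_continuousL2.mp (hφ.mem_continuousL2_of_step_eq hu)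
  have hp := hφ.coeFn_superpose_add_const hg F
  have hhat : ∀ k, fourierHat (fun x => φ x (g x) + F) k = (halfSymbol k : ℂ) * fourierHat g k := by
    intro k
    rw [← fourierHat_congr_ae hp, ← fourierHat_congr_ae hg]
    exact ((hφ.step_eq_iff F u).mp hu k).symm
  have hcont : Continuous fun x => φ x (g x) + F :=
    (hφ.continuous.comp (continuous_id.prodMk g.continuous)).add continuous_const
  refine ⟨g, ⟨⟨(memLp_congr_ae hg).mp (Lp.memLp u), ?_⟩, fun v hv => ?_⟩,
    ⟨_, ⟨g.continuous, hcont, hhat⟩, fun x => by ring⟩⟩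
  · have h := hφ.finiteEnergy_step F u
    rw [hu, FiniteEnergy, fourierHat_congr_ae hg] at h
    exact h
  · have hw := hv.1.coeFn_toLp
    rw [integral_mul_eq_inner hp hw, ← (hasSum_inner _ _).tsum_eq, halfForm, neg_add_eq_sub, eq_comm,
      sub_eq_zero]
    refine tsum_congr fun k => ?_
    rw [fourierHat_congr_ae hp, fourierHat_congr_ae hw, hhat, mul_assoc, Complex.re_ofReal_mul]

theorem exists_step_eq_of_isClassicalSolution (hφ : IsBoundedForce φ L M) {F : ℝ}
    {g : Torus n → ℝ} (hg : IsClassicalSolution φ F g) : ∃ u, hφ.step F u = u := by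
  obtain ⟨h, ⟨hgc, -, hhat⟩, heq⟩ := hg
  have hu := ContinuousMap.coeFn_toLp (p := 2) (𝕜 := ℝ) (torusMeasure n) ⟨g, hgc⟩
  refine ⟨ContinuousMap.toLp 2 (torusMeasure n) ℝ ⟨g, hgc⟩, (hφ.step_eq_iff F _).mpr fun k => ?_⟩
  have hh : h = fun x => φ x (g x) + F := funext fun x => by linarith [heq x]
  rw [fourierHat_congr_ae (hφ.coeFn_superpose_add_const hu F), fourierHat_congr_ae hu]
  exact (hh ▸ hhat k).symm

/-- Test with the resolvent of the defect d = T_F u - u. Since (L + s)d̂ is the residual of the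
equation at u, the weak form then reads ‖d‖² = 0. -/
theorem exists_step_eq_of_isWeakSolution (hφ : IsBoundedForce φ L M) {F : ℝ}
    {g : Torus n → ℝ} (hg : IsWeakSolution φ F g) : ∃ u, hφ.step F u = u := by
  obtain ⟨⟨hgL, -⟩, hweak⟩ := hg
  have hu := hgL.coeFn_toLp
  set u : L2 n := hgL.toLp with hudef
  refine ⟨u, ?_⟩
  set p : L2 n := hφ.superpose u + constL2 n F with hpdef
  have hp : p =ᵐ[torusMeasure n] fun x => φ x (g x) + F := hφ.coeFn_superpose_add_const hu F
  set d : L2 n := hφ.step F u - u with hd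
  set v : L2 n := resolvent hφ.pos d with hv
  have hw := hweak v ⟨Lp.memLp v, summable_halfSymbol_resolvent hφ.pos d⟩
  rw [integral_mul_eq_inner hp (Filter.EventuallyEq.refl _ _)] at hw
  have hterm : ∀ k, halfSymbol k * (fourierHat u k * (starRingEnd ℂ) (fourierHat v k)).re
      = (fourierHat p k * (starRingEnd ℂ) (fourierHat v k)).re
        - (fourierHat d k * (starRingEnd ℂ) (fourierHat d k)).re := by
    intro k
    have h1 : ((L + halfSymbol k : ℝ) : ℂ) * fourierHat d k
        = fourierHat p k - halfSymbol k * fourierHat u k := by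
      have h2 := fourierHat_resolvent' hφ.pos (L • u + p) k
      rw [fourierHat_add, fourierHat_smul] at h2
      rw [hd, fourierHat_sub, mul_sub, step, h2]
      push_cast
      ring
    have h3 : (starRingEnd ℂ) (fourierHat d k)
        = ((L + halfSymbol k : ℝ) : ℂ) * (starRingEnd ℂ) (fourierHat v k) := by
      rw [← fourierHat_resolvent' hφ.pos d k, map_mul, Complex.conj_ofReal]
    rw [← Complex.re_ofReal_mul, ← Complex.sub_re, h3]
    congr 1
    linear_combination (starRingEnd ℂ) (fourierHat v k) * h1
  have hform : halfForm g v = inner ℝ p v - inner ℝ d d := by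
    rw [halfForm, ← fourierHat_congr_ae hu]
    simp only [hterm]
    exact ((hasSum_inner p v).sub (hasSum_inner d d)).tsum_eq
  have h0 : inner ℝ d d = 0 := by linarith
  exact sub_eq_zero.mp (inner_self_eq_zero.mp h0)

end IsBoundedForce

end StickSlip

end

/-! ### The threshold as the largest solvable force -/

theorem theorem3p5 {n : ℕ} (φ : StickSlip.Torus n → ℝ → ℝ)
    (hφ : StickSlip.IsInteractionForce φ) :
    ∃ Fstar : ℝ, 0 ≤ Fstar ∧
      (∀ F : ℝ, 0 ≤ F → F ≤ Fstar →
        ∃ g : StickSlip.Torus n → ℝ,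
          StickSlip.IsWeakSolution φ F g ∧ StickSlip.IsClassicalSolution φ F g) ∧
      (∀ F : ℝ, Fstar < F →
        ¬ ∃ g : StickSlip.Torus n → ℝ,
          StickSlip.IsWeakSolution φ F g ∨ StickSlip.IsClassicalSolution φ F g) := by
  obtain ⟨L, M, hb⟩ := hφ.exists_isBoundedForce
  set S : Set ℝ := {F | ∃ u, hb.step F u = u} with hS
  have h0 : (0 : ℝ) ∈ S := hb.exists_step_zero_eq hφ
  have hbdd : BddAbove S := ⟨M, by
    rintro F ⟨u, hu⟩
    exact hb.le_bound_of_step_eq hu⟩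
  have hmax : sSup S ∈ S := by
    obtain ⟨G, -, hG, hGS⟩ := exists_seq_tendsto_sSup ⟨0, h0⟩ hbdd
    exact hb.exists_step_eq_of_tendsto_force hG hGS
  refine ⟨sSup S, le_csSup hbdd h0, fun F hF0 hF => ?_, fun F hF => ?_⟩
  · obtain ⟨a, ha⟩ := h0
    obtain ⟨b, hb'⟩ := hmax
    obtain ⟨u, hu⟩ := hb.exists_step_eq_of_between hF0 hF ha hb'
    exact hb.exists_solution_of_step_eq hu
  · rintro ⟨g, hg | hg⟩
    · exact not_le.mpr hF (le_csSup hbdd (hb.exists_step_eq_of_isWeakSolution hg))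
    · exact not_le.mpr hF (le_csSup hbdd (hb.exists_step_eq_of_isClassicalSolution hg))
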